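/- Let $d\ge 3$ and $0<\alpha<2$. Let $k:(\mathbb R^d\times\mathbb R^d)\setminus\mathrm{diag}\to[0,\infty)$ be a measurable symmetric function with $\sup_{x\in\mathbb R^d}\int_{\mathbb R^d}(1\wedge|y-x|^2)\,k(x,y)\,dy<\infty$. For an open set $\Omega\subset\mathbb R^d$ put $$\mathcal E_\Omega(u,v)=\int_\Omega\int_\Omega (u(y)-u(x))(v(y)-v(x))\,k(x,y)\,dy\,dx,\qquad \mathcal E=\mathcal E_{\mathbb R^d},$$ where $\mathcal E_\Omega(u,u)\in[0,\infty]$, and let $\mathcal E^\alpha_\Omega$ be the same expression with $k$ replaced by $$k^{(\alpha)}(x,y)=\frac{2^\alpha\,\Gamma(\frac{d+\alpha}2)}{\pi^{d/2}\,|\Gamma(-\frac\alpha2)|}\,|y-x|^{-d-\alpha}.$$ Let $H(\mathbb R^d;k)=\{u\in L^2(\mathbb R^d):\mathcal E(u,u)<\infty\}$ and $H_\Omega(\mathbb R^d;k)=\{u\in H(\mathbb R^d;k): u=0\text{ a.e. on }\mathbb R^d\setminus\Omega\}$. Consider, for constants $c_l,c_K>0$, the conditions - $(\mathcal E_\ge)$: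 $\mathcal E_B(u,u)\ge c_l\,\mathcal E^\alpha_B(u,u)$ (as elements of $[0,\infty]$) for every ball $B\subset\mathbb R^d$ and every $u\in L^2(B)$; - (U2): $k(x,y)\le c_K(2-\alpha)|y-x|^{-d-\alpha}$ for almost every $x,y\in\mathbb R^d$. **Theorem.** Let $d\ge3$, $q>1$, $c_l,c_K>0$ and $0<\alpha_0<2$. There is a constant $C>0$, depending only on $d$, $q$, $c_l$, $c_K$ and $\alpha_0$, such that the following holds for every $\alpha\in[\alpha_0,2)$, every $k$ as above satisfying $(\mathcal E_\ge)$ and (U2), every $x_0\in\mathbb R^d$ and every $r>0$. If $u\in H(\mathbb R^d;k)$ is a subsolution in $B_r(x_0)$, i.e. $$\mathcal E(u,\varphi)\le0\quad\text{for every nonnegative }\varphi\in H_{B_r(x_0)}(\mathbb R^d;k),$$ then, with $u_+=\max(u,0)$, $$\sup_{B_{r/2}(x_0)}u\le C\Big(\frac{1}{|B_r|}\int_{B_r(x_0)}u_+^q(x)\,dx\Big)^{1/q}+r^\alpha\int_{\mathbb R^d\setminus B_{r/2}(x_0)}\frac{u_+(y)}{|y-x_0|^{d+\alpha}}\,dy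 .$$ Here $\sup$ is the essential supremum, $|B_r|$ is the volume of $B_r(x_0)$, and the first term on the right is $+\infty$ if $u_+^q$ is not integrable on $B_r(x_0)$. -/

import Mathlib

open MeasureTheory Metric
open scoped ENNReal

noncomputable section

namespace Nonlocal

/-- A measurable symmetric kernel `k : (ℝ^d × ℝ^d) \ diag → [0, ∞)` with
`sup_x ∫ (1 ∧ |y - x|²) k(x, y) dy < ∞`. The values of the total function `k` on the diagonal (a null
set on which every integrand below vanishes) are irrelevant and unconstrained. Measurability is
Lebesgue measurability. -/
structure IsKernel {d : ℕ} (k : EuclideanSpace ℝ (Fin d) → EuclideanSpace ℝ (Fin d) → ℝ) :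
    Prop where
  aemeasurable : AEMeasurable
    (fun p : EuclideanSpace ℝ (Fin d) × EuclideanSpace ℝ (Fin d) => k p.1 p.2) volume
  nonneg : ∀ x y, x ≠ y → 0 ≤ k x y
  symm : ∀ x y, k x y = k y x
  levy : (⨆ x, ∫⁻ y, ENNReal.ofReal (min 1 (‖y - x‖ ^ 2) * k x y)) < ∞

/-- The kernel of the fractional Laplacian,
`k^{(α)}(x, y) = 2^α Γ((d + α) / 2) / (π^{d/2} |Γ(-α / 2)|) |y - x|^{-d-α}`. -/
def fracKernel {d : ℕ} (α : ℝ) (x y : EuclideanSpace ℝ (Fin d)) : ℝ :=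
  2 ^ α * Real.Gamma (((d : ℝ) + α) / 2) / (Real.pi ^ ((d : ℝ) / 2) * |Real.Gamma (-α / 2)|) *
    ‖y - x‖ ^ (-(d : ℝ) - α)

/-- The quadratic form `𝓔_Ω(u, u) = ∫_Ω ∫_Ω (u(y) - u(x))² k(x, y) dy dx ∈ [0, ∞]`. -/
def energy {d : ℕ} (k : EuclideanSpace ℝ (Fin d) → EuclideanSpace ℝ (Fin d) → ℝ)
    (Ω : Set (EuclideanSpace ℝ (Fin d))) (u : EuclideanSpace ℝ (Fin d) → ℝ) : ℝ≥0∞ :=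
  ∫⁻ x in Ω, ∫⁻ y in Ω, ENNReal.ofReal ((u y - u x) ^ 2 * k x y)

/-- The bilinear form
`𝓔(u, v) = ∫ ∫ (u(y) - u(x)) (v(y) - v(x)) k(x, y) dy dx` over `ℝ^d × ℝ^d`. It is only used for
`u, v` of finite energy, where the integral converges absolutely. -/
def form {d : ℕ} (k : EuclideanSpace ℝ (Fin d) → EuclideanSpace ℝ (Fin d) → ℝ)
    (u v : EuclideanSpace ℝ (Fin d) → ℝ) : ℝ :=
  ∫ x, ∫ y, (u y - u x) * (v y - v x) * k x y

/-- `u ∈ H(ℝ^d; k)`: `u ∈ L²(ℝ^d)` and `𝓔(u, u) < ∞`. -/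
def MemH {d : ℕ} (k : EuclideanSpace ℝ (Fin d) → EuclideanSpace ℝ (Fin d) → ℝ)
    (u : EuclideanSpace ℝ (Fin d) → ℝ) : Prop :=
  MemLp u 2 volume ∧ energy k Set.univ u < ∞

/-- `u ∈ H_Ω(ℝ^d; k)`: `u ∈ H(ℝ^d; k)` and `u = 0` a.e. on `ℝ^d \ Ω`. -/
def MemHOn {d : ℕ} (k : EuclideanSpace ℝ (Fin d) → EuclideanSpace ℝ (Fin d) → ℝ)
    (Ω : Set (EuclideanSpace ℝ (Fin d))) (u : EuclideanSpace ℝ (Fin d) → ℝ) : Prop :=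
  MemH k u ∧ ∀ᵐ x ∂volume.restrict Ωᶜ, u x = 0

/-- Condition `(𝓔_≥)`: `𝓔_B(u, u) ≥ c_l 𝓔^α_B(u, u)` in `[0, ∞]` for every ball `B` and every
`u ∈ L²(B)`. -/
def EnergyLowerBound {d : ℕ} (k : EuclideanSpace ℝ (Fin d) → EuclideanSpace ℝ (Fin d) → ℝ)
    (α cl : ℝ) : Prop :=
  ∀ (x₀ : EuclideanSpace ℝ (Fin d)) (r : ℝ), 0 < r →
    ∀ u : EuclideanSpace ℝ (Fin d) → ℝ, MemLp u 2 (volume.restrict (ball x₀ r)) →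
      ENNReal.ofReal cl * energy (fracKernel α) (ball x₀ r) u ≤ energy k (ball x₀ r) u

/-- Condition `(U2)`: `k(x, y) ≤ c_K (2 - α) |y - x|^{-d-α}` for almost every `x, y`. -/
def KernelUpperBound {d : ℕ} (k : EuclideanSpace ℝ (Fin d) → EuclideanSpace ℝ (Fin d) → ℝ)
    (α cK : ℝ) : Prop :=
  ∀ᵐ p : EuclideanSpace ℝ (Fin d) × EuclideanSpace ℝ (Fin d),
    k p.1 p.2 ≤ cK * (2 - α) * ‖p.2 - p.1‖ ^ (-(d : ℝ) - α)

/-- `u` is a subsolution in `Ω`: `𝓔(u, φ) ≤ 0` for every nonnegative `φ ∈ H_Ω(ℝ^d; k)`. -/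
def IsSubsolution {d : ℕ} (k : EuclideanSpace ℝ (Fin d) → EuclideanSpace ℝ (Fin d) → ℝ)
    (Ω : Set (EuclideanSpace ℝ (Fin d))) (u : EuclideanSpace ℝ (Fin d) → ℝ) : Prop :=
  ∀ φ : EuclideanSpace ℝ (Fin d) → ℝ, MemHOn k Ω φ → (∀ᵐ x, 0 ≤ φ x) → form k u φ ≤ 0

/-- The average `(⨍_{B_r(x₀)} u_+^q)^{1/q} ∈ [0, ∞]`. -/
def posAverage {d : ℕ} (q : ℝ) (x₀ : EuclideanSpace ℝ (Fin d)) (r : ℝ)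
    (u : EuclideanSpace ℝ (Fin d) → ℝ) : ℝ≥0∞ :=
  (⨍⁻ x in ball x₀ r, ENNReal.ofReal (max (u x) 0 ^ q) ∂volume) ^ (1 / q)

/-- The integral `∫_{ℝ^d \ B_ρ(x₀)} u_+(y) |y - x₀|^{-d-α} dy ∈ [0, ∞]`. -/
def tail {d : ℕ} (α : ℝ) (x₀ : EuclideanSpace ℝ (Fin d)) (ρ : ℝ)
    (u : EuclideanSpace ℝ (Fin d) → ℝ) : ℝ≥0∞ :=
  ∫⁻ y in (ball x₀ ρ)ᶜ, ENNReal.ofReal (max (u y) 0 * ‖y - x₀‖ ^ (-(d : ℝ) - α))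

end Nonlocal

end

/-! The proof is a De Giorgi iteration in which a Faber–Krahn inequality takes the place of the
Sobolev inequality, and every constant stays bounded as `α → 2`.

Lower bound. Write the fractional energy over pairs at distance less than `s` as an integral over
shifts `h` of the squared `L²` norm of `v(· + h) - v`. Doubling a shift multiplies this norm by at
most four, so the shell `s/2 ≤ |h| < s` carries at most the fraction `2 - α` of the total
(`lintegral_annulus_le`). If `v` vanishes outside a set much smaller than `B_s`, most shifts in the
shell lead to zeros of `v`, and the shell already controls `‖v‖²` (`faberKrahn`). The factor `2 - α`
gained here is the one in the normalizing constant, so `(𝓔_≥)` gives `𝓔(v, v) ≥ c s^{-α} ‖v‖²`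
(`exists_energy_lower`).

Upper bound. Testing with `g² (u - l)₊` bounds the energy of `g (u - l)₊`
(`IsSubsolution.caccioppoli`). By (U2) the result splits into a local `L²` term and a tail times an
`L¹` norm (`lintegral_cutoff_le`); the factor `2 - α` cancels the divergence of the local integral.

Choosing `s` by Chebyshev from the superlevel set makes the combined estimate superlinear in the
truncated mass (`exists_deGiorgi_step`), and iteration gives `u ≤ M` once the mass is small and the
tail is at most `M` (`exists_deGiorgi_bound`). The tail enters only through this comparison, hence
its coefficient one in the theorem. Exponents below two are reached by descending through levels `M
bⁿ` on shrinking balls (`exists_local_bound`), exponents above two by Jensen (`posAverage_mono`). -/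

namespace Nonlocal

section

variable {d : ℕ}

local notation "𝔼" => EuclideanSpace ℝ (Fin d)

/-! ### Translation defects and a Faber–Krahn inequality uniform in `α` -/

/-- The squared `L²` distance between `v` and its translate by `h`. -/
noncomputable def translationDefect (v : 𝔼 → ℝ) (h : 𝔼) : ℝ≥0∞ :=
  ∫⁻ x, ENNReal.ofReal ((v (x + h) - v x) ^ 2)

theorem measurable_translationDefect {v : 𝔼 → ℝ} (hv : Measurable v) :
    Measurable (translationDefect v) := by
  unfold translationDefect
  apply Measurable.lintegral_prod_right'
    (f := fun p : 𝔼 × 𝔼 => ENNReal.ofReal ((v (p.2 + p.1) - v p.2) ^ 2))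
  fun_prop

/-- The shift by `2h` is two shifts by `h`, each with the same defect by translation invariance;
then `(a + b)² ≤ 2a² + 2b²`. -/
theorem translationDefect_two_smul_le {v : 𝔼 → ℝ} (hv : Measurable v) (h : 𝔼) :
    translationDefect v ((2 : ℝ) • h) ≤ 4 * translationDefect v h := by
  have h1 : ∫⁻ x, ENNReal.ofReal ((v (x + h + h) - v (x + h)) ^ 2) = translationDefect v h :=
    lintegral_add_right_eq_self (fun x => ENNReal.ofReal ((v (x + h) - v x) ^ 2)) h
  calc translationDefect v ((2 : ℝ) • h)
      ≤ ∫⁻ x, (2 * ENNReal.ofReal ((v (x + h + h) - v (x + h)) ^ 2) +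
          2 * ENNReal.ofReal ((v (x + h) - v x) ^ 2)) := by
        refine lintegral_mono fun x => ?_
        have e2 (t : ℝ) (ht : 0 ≤ t) : 2 * ENNReal.ofReal t = ENNReal.ofReal (2 * t) := by
          rw [ENNReal.ofReal_mul (by norm_num)]; simp
        rw [two_smul, ← add_assoc, e2 _ (by positivity), e2 _ (by positivity),
          ← ENNReal.ofReal_add (by positivity) (by positivity)]
        apply ENNReal.ofReal_le_ofReal
        nlinarith [sq_nonneg ((v (x + h + h) - v (x + h)) - (v (x + h) - v x))]
    _ = 4 * translationDefect v h := by
        rw [lintegral_add_left (by fun_prop), lintegral_const_mul _ (by fun_prop),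
          lintegral_const_mul _ (by fun_prop), h1]
        change 2 * translationDefect v h + 2 * translationDefect v h = _
        ring

theorem lintegral_comp_half_smul {f : 𝔼 → ℝ≥0∞} (hf : Measurable f) :
    ∫⁻ h, f ((2⁻¹ : ℝ) • h) = ENNReal.ofReal (2 ^ (d : ℝ)) * ∫⁻ h, f h := by
  have h2 := Measure.map_addHaar_smul (volume : Measure 𝔼) (r := (2⁻¹ : ℝ)) (by norm_num)
  rw [← lintegral_map (g := fun h : 𝔼 => (2⁻¹ : ℝ) • h) hf (by fun_prop), h2,
    lintegral_smul_measure, smul_eq_mul]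
  congr 2
  simp [abs_of_pos]

/-- Substituting `h ↦ h/2` carries one ball to the other. Doubling the shift costs `4`, the kernel
`2^{-d-α}` and the volume `2^d`, in total `2^{2-α}`. -/
theorem lintegral_ball_le_half {v : 𝔼 → ℝ} (hv : Measurable v) (α s : ℝ) :
    ENNReal.ofReal (2 ^ (α - 2)) *
        ∫⁻ h in ball 0 s, translationDefect v h * ENNReal.ofReal (‖h‖ ^ (-(d : ℝ) - α)) ≤
      ∫⁻ h in ball 0 (s / 2),
        translationDefect v h * ENNReal.ofReal (‖h‖ ^ (-(d : ℝ) - α)) := by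
  set G : 𝔼 → ℝ≥0∞ :=
    fun h => translationDefect v h * ENNReal.ofReal (‖h‖ ^ (-(d : ℝ) - α)) with hG
  have hGm : Measurable G := (measurable_translationDefect hv).mul (by fun_prop)
  have key : ∫⁻ h in ball 0 s, G h ≤
      ENNReal.ofReal (4 * 2 ^ (-(d : ℝ) - α)) * (ENNReal.ofReal (2 ^ (d : ℝ)) *
        ∫⁻ h in ball 0 (s / 2), G h) := by
    rw [← lintegral_indicator measurableSet_ball, ← lintegral_indicator measurableSet_ball,
      ← lintegral_comp_half_smul (hGm.indicator measurableSet_ball)]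
    have hm : Measurable fun h : 𝔼 => (ball (0 : 𝔼) (s / 2)).indicator G ((2⁻¹ : ℝ) • h) :=
      (hGm.indicator measurableSet_ball).comp (measurable_const_smul (2⁻¹ : ℝ))
    rw [← lintegral_const_mul _ hm]
    refine lintegral_mono fun h => ?_
    by_cases hh : h ∈ ball (0 : 𝔼) s
    · have hh' : (2⁻¹ : ℝ) • h ∈ ball (0 : 𝔼) (s / 2) := by
        rw [mem_ball_zero_iff] at hh ⊢
        rw [norm_smul]
        norm_num
        linarith
      rw [Set.indicator_of_mem hh, Set.indicator_of_mem hh']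
      have e1 : translationDefect v h ≤ 4 * translationDefect v ((2⁻¹ : ℝ) • h) := by
        have := translationDefect_two_smul_le hv ((2⁻¹ : ℝ) • h)
        rwa [smul_smul, mul_inv_cancel₀ (by norm_num), one_smul] at this
      have e2 : ‖h‖ ^ (-(d : ℝ) - α) =
          2 ^ (-(d : ℝ) - α) * ‖(2⁻¹ : ℝ) • h‖ ^ (-(d : ℝ) - α) := by
        rw [← Real.mul_rpow (by norm_num) (norm_nonneg _), norm_smul, ← mul_assoc]
        norm_num
      calc G h ≤ (4 * translationDefect v ((2⁻¹ : ℝ) • h)) *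
            ENNReal.ofReal (2 ^ (-(d : ℝ) - α) * ‖(2⁻¹ : ℝ) • h‖ ^ (-(d : ℝ) - α)) := by
            rw [← e2]; exact mul_le_mul_left e1 _
        _ = _ := by
            rw [ENNReal.ofReal_mul (by positivity), ENNReal.ofReal_mul (by norm_num), hG]
            simp only [ENNReal.ofReal_ofNat]
            ring
    · rw [Set.indicator_of_notMem hh]; exact zero_le
  calc _ ≤ ENNReal.ofReal (2 ^ (α - 2)) * (ENNReal.ofReal (4 * 2 ^ (-(d : ℝ) - α)) *
        (ENNReal.ofReal (2 ^ (d : ℝ)) * ∫⁻ h in ball 0 (s / 2), G h)) := by gcongr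
    _ = _ := by
      rw [← mul_assoc, ← mul_assoc, ← ENNReal.ofReal_mul (by positivity),
        ← ENNReal.ofReal_mul (by positivity)]
      have : (2 : ℝ) ^ (α - 2) * (4 * 2 ^ (-(d : ℝ) - α)) * 2 ^ (d : ℝ) = 1 := by
        rw [show (4 : ℝ) = 2 ^ (2 : ℝ) by norm_num, ← Real.rpow_add (by norm_num),
          ← Real.rpow_add (by norm_num), ← Real.rpow_add (by norm_num)]
        ring_nf
        simp
      rw [this]; simp

theorem one_sub_two_rpow_le {α : ℝ} (hα : α < 2) : 1 - 2 ^ (α - 2) ≤ 2 - α := by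
  have h1 : (2 : ℝ) ^ (α - 2) = Real.exp (Real.log 2 * (α - 2)) :=
    Real.rpow_def_of_pos (by norm_num) _
  have h2 := Real.add_one_le_exp (Real.log 2 * (α - 2))
  have h3 : Real.log 2 ≤ 1 := by linarith [Real.log_two_lt_d9]
  rw [h1]
  nlinarith

/-- The inner ball holds at least the fraction `2^{α-2}` of the integral, which leaves the shell at
most `1 - 2^{α-2} ≤ 2 - α`. This is the source of uniformity as `α → 2`. -/
theorem lintegral_annulus_le {v : 𝔼 → ℝ} (hv : Measurable v) {α : ℝ}
    (hα2 : α < 2) (s : ℝ) (hs : 0 < s) :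
    ∫⁻ h in ball 0 s \ ball 0 (s / 2),
        translationDefect v h * ENNReal.ofReal (‖h‖ ^ (-(d : ℝ) - α)) ≤
      ENNReal.ofReal (2 - α) *
        ∫⁻ h in ball 0 s, translationDefect v h * ENNReal.ofReal (‖h‖ ^ (-(d : ℝ) - α)) := by
  set G : 𝔼 → ℝ≥0∞ :=
    fun h => translationDefect v h * ENNReal.ofReal (‖h‖ ^ (-(d : ℝ) - α)) with hG
  set Φ := ∫⁻ h in ball 0 s, G h
  -- The infinite case is separated because a multiple of `Φ` is cancelled below.
  by_cases hΦ : Φ = ∞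
  · rw [hΦ, ENNReal.mul_top (by simpa using hα2)]; exact le_top
  have h1 : Φ = (∫⁻ h in ball 0 (s / 2), G h) + ∫⁻ h in ball 0 s \ ball 0 (s / 2), G h := by
    change ∫⁻ h in ball 0 s, G h = _
    rw [← lintegral_inter_add_sdiff G (ball 0 s) (measurableSet_ball (x := 0) (ε := s / 2)),
      Set.inter_eq_right.2 (ball_subset_ball (by linarith))]
  have h2 : ENNReal.ofReal (2 ^ (α - 2)) * Φ ≤ ∫⁻ h in ball 0 (s / 2), G h :=
    lintegral_ball_le_half hv α s
  have hp : (2 : ℝ) ^ (α - 2) ≤ 1 :=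
    Real.rpow_le_one_of_one_le_of_nonpos (by norm_num) (by linarith)
  have h3 : Φ = ENNReal.ofReal (2 ^ (α - 2)) * Φ + ENNReal.ofReal (1 - 2 ^ (α - 2)) * Φ := by
    rw [← add_mul, ← ENNReal.ofReal_add (by positivity) (by linarith)]
    simp
  have h4 : ENNReal.ofReal (2 ^ (α - 2)) * Φ + ∫⁻ h in ball 0 s \ ball 0 (s / 2), G h ≤
      ENNReal.ofReal (2 ^ (α - 2)) * Φ + ENNReal.ofReal (1 - 2 ^ (α - 2)) * Φ := by
    rw [← h3]
    conv_rhs => rw [h1]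
    gcongr
  refine ((ENNReal.add_le_add_iff_left (ENNReal.mul_ne_top (by simp) hΦ)).1 h4).trans ?_
  exact mul_le_mul' (ENNReal.ofReal_le_ofReal (one_sub_two_rpow_le hα2)) le_rfl

/-- A Faber–Krahn inequality for the nonlocal energy with the kernel `(2 - α) |y - x|^{-d-α}`,
with a constant which does not depend on `α`. -/
theorem faberKrahn (hd : 1 ≤ d) {v : 𝔼 → ℝ} (hv : Measurable v) {α : ℝ}
    (hα : 0 < α) (hα2 : α < 2) {s : ℝ} (hs : 0 < s) {A : Set 𝔼} (hA : MeasurableSet A)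
    (hvA : ∀ x ∉ A, v x = 0)
    (hA' : volume A ≤ ENNReal.ofReal (s ^ d / 4) * volume (ball (0 : 𝔼) 1)) :
    ENNReal.ofReal (s ^ (-α) / 4) * volume (ball (0 : 𝔼) 1) * ∫⁻ x, ENNReal.ofReal (v x ^ 2) ≤
      ENNReal.ofReal (2 - α) * ∫⁻ x, ∫⁻ y in ball x s,
        ENNReal.ofReal ((v y - v x) ^ 2 * ‖y - x‖ ^ (-(d : ℝ) - α)) := by
  have : Nonempty (Fin d) := ⟨⟨0, hd⟩⟩
  set G : 𝔼 → ℝ≥0∞ :=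
    fun h => translationDefect v h * ENNReal.ofReal (‖h‖ ^ (-(d : ℝ) - α)) with hG
  have hswap : ∫⁻ x, ∫⁻ y in ball x s,
      ENNReal.ofReal ((v y - v x) ^ 2 * ‖y - x‖ ^ (-(d : ℝ) - α)) =
      ∫⁻ h in ball 0 s, G h := by
    have e1 : ∀ x : 𝔼, ∫⁻ y in ball x s,
        ENNReal.ofReal ((v y - v x) ^ 2 * ‖y - x‖ ^ (-(d : ℝ) - α)) =
        ∫⁻ h in ball 0 s, ENNReal.ofReal ((v (x + h) - v x) ^ 2) *
          ENNReal.ofReal (‖h‖ ^ (-(d : ℝ) - α)) := by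
      intro x
      rw [← lintegral_indicator measurableSet_ball, ← lintegral_indicator measurableSet_ball,
        ← lintegral_add_left_eq_self _ x]
      refine lintegral_congr fun h => ?_
      by_cases hh : h ∈ ball (0 : 𝔼) s
      · rw [Set.indicator_of_mem hh, Set.indicator_of_mem (by simpa using hh),
          ENNReal.ofReal_mul (by positivity)]
        simp
      · rw [Set.indicator_of_notMem hh, Set.indicator_of_notMem (by simpa using hh)]
    simp_rw [e1]
    rw [lintegral_lintegral_swap]
    · refine lintegral_congr fun h => ?_
      rw [lintegral_mul_const _ (by fun_prop)]
      rfl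
    · apply Measurable.aemeasurable
      fun_prop
  rw [hswap]
  refine le_trans ?_ (lintegral_annulus_le hv hα2 s hs)
  set N : Set 𝔼 := ball 0 s \ ball 0 (s / 2) with hN
  have hNm : MeasurableSet N := measurableSet_ball.diff measurableSet_ball
  have step1 : ENNReal.ofReal (s ^ (-(d : ℝ) - α)) * ∫⁻ h in N, translationDefect v h ≤
      ∫⁻ h in N, G h := by
    rw [← lintegral_const_mul _ (measurable_translationDefect hv)]
    refine setLIntegral_mono' hNm fun h hh => ?_
    rw [mul_comm]
    have h1 : ‖h‖ < s := by simpa using hh.1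
    have h2 : s / 2 ≤ ‖h‖ := by simpa using hh.2
    simp only [hG]
    refine mul_le_mul' le_rfl (ENNReal.ofReal_le_ofReal ?_)
    exact Real.rpow_le_rpow_of_nonpos (by linarith) h1.le
      (by have : (0 : ℝ) ≤ d := by positivity
          linarith)
  have hb : volume (ball (0 : 𝔼) s) = ENNReal.ofReal (s ^ d) * volume (ball (0 : 𝔼) 1) := by
    simpa using Measure.addHaar_ball (volume : Measure 𝔼) 0 hs.le
  have hb2 : volume (ball (0 : 𝔼) (s / 2)) ≤
      ENNReal.ofReal (s ^ d / 2) * volume (ball (0 : 𝔼) 1) := by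
    rw [Measure.addHaar_ball (volume : Measure 𝔼) 0 (by positivity : 0 ≤ s / 2)]
    gcongr
    rw [finrank_euclideanSpace_fin, div_pow]
    gcongr
    calc (2 : ℝ) = 2 ^ 1 := by norm_num
      _ ≤ 2 ^ d := pow_le_pow_right₀ (by norm_num) hd
  have hωt : volume (ball (0 : 𝔼) 1) ≠ ∞ := measure_ball_lt_top.ne
  -- For every base point, at least a quarter of the ball consists of shifts in the shell that leave
  -- `A`: the inner ball removes at most half, and `A` at most a quarter.
  have hNA : ∀ x : 𝔼, ENNReal.ofReal (s ^ d / 4) * volume (ball (0 : 𝔼) 1) ≤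
      volume (N \ {h | x + h ∈ A}) := by
    intro x
    have hs1 : ball (0 : 𝔼) s ⊆ (N \ {h | x + h ∈ A}) ∪ (ball 0 (s / 2) ∪ {h | x + h ∈ A}) := by
      intro h hh
      by_cases c1 : h ∈ ball (0 : 𝔼) (s / 2)
      · exact Or.inr (Or.inl c1)
      by_cases c2 : x + h ∈ A
      · exact Or.inr (Or.inr c2)
      · exact Or.inl ⟨⟨hh, c1⟩, c2⟩
    have hAx : volume {h | x + h ∈ A} = volume A := measure_preimage_add volume x A
    have := (measure_mono (μ := volume) hs1).trans
      ((measure_union_le _ _).trans (add_le_add_right (measure_union_le _ _) _))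
    rw [hAx, hb] at this
    have h3 : ENNReal.ofReal (s ^ d) * volume (ball (0 : 𝔼) 1) =
        ENNReal.ofReal (s ^ d / 4) * volume (ball (0 : 𝔼) 1) +
        (ENNReal.ofReal (s ^ d / 2) * volume (ball (0 : 𝔼) 1) +
          ENNReal.ofReal (s ^ d / 4) * volume (ball (0 : 𝔼) 1)) := by
      rw [← add_mul, ← add_mul, ← ENNReal.ofReal_add (by positivity) (by positivity),
        ← ENNReal.ofReal_add (by positivity) (by positivity)]
      congr 2
      ring
    have h4 := (h3 ▸ this).trans (add_le_add_right (add_le_add hb2 hA') _)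
    refine (ENNReal.add_le_add_iff_right ?_).1 h4
    finiteness
  have step2 : ENNReal.ofReal (s ^ d / 4) * volume (ball (0 : 𝔼) 1) *
      ∫⁻ x, ENNReal.ofReal (v x ^ 2) ≤ ∫⁻ h in N, translationDefect v h := by
    unfold translationDefect
    rw [lintegral_lintegral_swap (by apply Measurable.aemeasurable; fun_prop),
      ← lintegral_const_mul _ (by fun_prop)]
    refine lintegral_mono fun x => ?_
    calc _ ≤ volume (N \ {h | x + h ∈ A}) * ENNReal.ofReal (v x ^ 2) := by
          gcongr; exact hNA x
      _ = ∫⁻ h in N \ {h | x + h ∈ A}, ENNReal.ofReal (v x ^ 2) := by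
          rw [setLIntegral_const, mul_comm]
      _ = ∫⁻ h in N \ {h | x + h ∈ A}, ENNReal.ofReal ((v (x + h) - v x) ^ 2) := by
          refine setLIntegral_congr_fun (hNm.diff ((measurable_const_add x) hA)) fun h hh => ?_
          simp [hvA _ hh.2]
      _ ≤ _ := lintegral_mono_set Set.sdiff_subset
  calc _ = ENNReal.ofReal (s ^ (-(d : ℝ) - α)) * (ENNReal.ofReal (s ^ d / 4) *
        volume (ball (0 : 𝔼) 1) * ∫⁻ x, ENNReal.ofReal (v x ^ 2)) := by
        rw [← mul_assoc, ← mul_assoc, ← ENNReal.ofReal_mul (by positivity)]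
        congr 3
        rw [← Real.rpow_natCast, mul_div_assoc', ← Real.rpow_add hs]
        ring_nf
    _ ≤ _ := by gcongr
    _ ≤ _ := step1

/-! ### The normalizing constant of the fractional Laplacian -/

/-- Two uses of the functional equation make the pole of `Γ(-α/2)` at `α = 2` explicit. -/
theorem abs_Gamma_neg_half {α : ℝ} (hα : 0 < α) (hα2 : α < 2) :
    |Real.Gamma (-α / 2)| = Real.Gamma (2 - α / 2) / (α / 2 * (1 - α / 2)) := by
  have h1 : Real.Gamma (2 - α / 2) = (1 - α / 2) * (-α / 2 * Real.Gamma (-α / 2)) := by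
    rw [show 2 - α / 2 = (1 - α / 2) + 1 by ring, Real.Gamma_add_one (by linarith),
      show 1 - α / 2 = -α / 2 + 1 by ring, Real.Gamma_add_one (by linarith)]
  have h2 : 0 < Real.Gamma (2 - α / 2) := Real.Gamma_pos_of_pos (by linarith)
  have h3 : 0 < α / 2 * (1 - α / 2) := mul_pos (by linarith) (by linarith)
  have h4 : Real.Gamma (-α / 2) < 0 := by
    by_contra h
    have : 0 ≤ α / 2 * (1 - α / 2) * Real.Gamma (-α / 2) := mul_nonneg h3.le (not_lt.1 h)
    nlinarith
  rw [abs_of_neg h4, eq_div_iff h3.ne', h1]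
  ring

/-- The normalizing constant of the fractional Laplacian is bounded below by a multiple of `2 - α`,
uniformly for `α` away from `0`. -/
theorem exists_fracConst_lower (hd : 1 ≤ d) {α₀ : ℝ} (hα₀ : 0 < α₀) :
    ∃ c : ℝ, 0 < c ∧ ∀ α : ℝ, α₀ ≤ α → α < 2 → c * (2 - α) ≤
      2 ^ α * Real.Gamma (((d : ℝ) + α) / 2) /
        (Real.pi ^ ((d : ℝ) / 2) * |Real.Gamma (-α / 2)|) := by
  have hd' : (1 : ℝ) ≤ d := by exact_mod_cast hd
  have hK : IsCompact (Set.Icc ((d : ℝ) / 2) (d / 2 + 1)) := isCompact_Icc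
  have hcont : ContinuousOn Real.Gamma (Set.Icc ((d : ℝ) / 2) (d / 2 + 1)) := by
    intro x hx
    refine (Real.differentiableAt_Gamma fun m => ?_).continuousAt.continuousWithinAt
    have : (0 : ℝ) ≤ m := by positivity
    have := hx.1
    linarith
  obtain ⟨x₁, hx₁, hmin⟩ := hK.exists_isMinOn ⟨(d : ℝ) / 2, by simp⟩ hcont
  have hγ : 0 < Real.Gamma x₁ := Real.Gamma_pos_of_pos (by linarith [hx₁.1])
  have hπ : 0 < Real.pi ^ ((d : ℝ) / 2) := by positivity
  refine ⟨Real.Gamma x₁ / Real.pi ^ ((d : ℝ) / 2) * (α₀ / 4), by positivity,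
    fun α hα hα2 => ?_⟩
  have hα' : 0 < α := hα₀.trans_le hα
  rw [abs_Gamma_neg_half hα' hα2]
  have hg2 : 0 < Real.Gamma (2 - α / 2) := Real.Gamma_pos_of_pos (by linarith)
  -- `Γ` is convex and equals one at both `1` and `2`.
  have hg1 : Real.Gamma (2 - α / 2) ≤ 1 := by
    have := Real.convexOn_Gamma.2 (show (1 : ℝ) ∈ Set.Ioi 0 by simp)
      (show (2 : ℝ) ∈ Set.Ioi 0 by simp) (show 0 ≤ α / 2 by linarith)
      (show 0 ≤ 1 - α / 2 by linarith) (by ring)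
    rw [Real.Gamma_one, Real.Gamma_two] at this
    simp only [smul_eq_mul] at this
    rw [show α / 2 * 1 + (1 - α / 2) * 2 = 2 - α / 2 by ring] at this
    linarith
  have hg3 : Real.Gamma x₁ ≤ Real.Gamma (((d : ℝ) + α) / 2) :=
    hmin ⟨by linarith, by linarith⟩
  have h2 : (1 : ℝ) ≤ 2 ^ α := Real.one_le_rpow (by norm_num) hα'.le
  have h3 : 0 < α / 2 * (1 - α / 2) := mul_pos (by linarith) (by linarith)
  have e : 2 ^ α * Real.Gamma (((d : ℝ) + α) / 2) / (Real.pi ^ ((d : ℝ) / 2) *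
      (Real.Gamma (2 - α / 2) / (α / 2 * (1 - α / 2)))) =
      2 ^ α * Real.Gamma (((d : ℝ) + α) / 2) / Real.pi ^ ((d : ℝ) / 2) *
        (α / 2 * (1 - α / 2)) / Real.Gamma (2 - α / 2) := by
    field_simp
  rw [e, le_div_iff₀ hg2]
  have h4 : Real.Gamma x₁ / Real.pi ^ ((d : ℝ) / 2) ≤
      2 ^ α * Real.Gamma (((d : ℝ) + α) / 2) / Real.pi ^ ((d : ℝ) / 2) := by
    gcongr
    nlinarith
  have h5 : α₀ / 4 * (2 - α) ≤ α / 2 * (1 - α / 2) := by nlinarith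
  calc _ ≤ Real.Gamma x₁ / Real.pi ^ ((d : ℝ) / 2) * (α₀ / 4) * (2 - α) * 1 := by
        refine mul_le_mul_of_nonneg_left hg1 ?_
        have : 0 ≤ 2 - α := by linarith
        positivity
    _ = Real.Gamma x₁ / Real.pi ^ ((d : ℝ) / 2) * (α₀ / 4 * (2 - α)) := by ring
    _ ≤ _ := mul_le_mul h4 h5 (mul_nonneg (by positivity) (by linarith))
        (le_trans (by positivity) h4)

/-! ### Faber–Krahn inequality under `(𝓔_≥)` -/

theorem energy_mono {k : 𝔼 → 𝔼 → ℝ} {Ω Ω' : Set 𝔼} (h : Ω ⊆ Ω') (u : 𝔼 → ℝ) :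
    energy k Ω u ≤ energy k Ω' u :=
  (lintegral_mono_set h).trans (lintegral_mono fun _ => lintegral_mono_set h)

/-- For a function supported in a ball, pairs of points at distance less than `s` at which the
integrand does not vanish lie in the ball enlarged by `s`. -/
theorem lintegral_near_le_energy {k : 𝔼 → 𝔼 → ℝ} {v : 𝔼 → ℝ} {x₀ : 𝔼} {r s : ℝ}
    (hv : ∀ x ∉ ball x₀ r, v x = 0) :
    ∫⁻ x, ∫⁻ y in ball x s, ENNReal.ofReal ((v y - v x) ^ 2 * k x y) ≤
      energy k (ball x₀ (r + s)) v := by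
  unfold energy
  rw [← lintegral_indicator measurableSet_ball]
  refine lintegral_mono fun x => ?_
  have key : ∀ y ∈ ball x s, x ∉ ball x₀ (r + s) ∨ y ∉ ball x₀ (r + s) →
      ENNReal.ofReal ((v y - v x) ^ 2 * k x y) = 0 := by
    intro y hy h
    have hxy : dist y x < s := hy
    have hs : 0 < s := dist_nonneg.trans_lt hxy
    have h1 : x ∉ ball x₀ r ∧ y ∉ ball x₀ r := by
      simp only [mem_ball, not_lt] at h ⊢
      have := dist_triangle x y x₀
      have := dist_triangle y x x₀
      rw [dist_comm x y] at *
      rcases h with h | h <;> constructor <;> linarith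
    rw [hv x h1.1, hv y h1.2]
    simp
  rw [← lintegral_indicator measurableSet_ball]
  by_cases hx : x ∈ ball x₀ (r + s)
  · rw [Set.indicator_of_mem hx, ← lintegral_indicator measurableSet_ball]
    refine lintegral_mono fun y => ?_
    by_cases hy : y ∈ ball x s
    · rw [Set.indicator_of_mem hy]
      by_cases hy' : y ∈ ball x₀ (r + s)
      · rw [Set.indicator_of_mem hy']
      · rw [key y hy (Or.inr hy')]; exact zero_le
    · rw [Set.indicator_of_notMem hy]; exact zero_le
  · rw [Set.indicator_of_notMem hx]
    refine le_of_eq (lintegral_eq_zero_of_ae_eq_zero (Filter.Eventually.of_forall fun y => ?_))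
    by_cases hy : y ∈ ball x s
    · rw [Set.indicator_of_mem hy]; exact key y hy (Or.inl hx)
    · rw [Set.indicator_of_notMem hy]; rfl

/-- The Faber–Krahn inequality for the energies satisfying `(𝓔_≥)`, uniformly in `α`. -/
theorem exists_energy_lower (hd : 1 ≤ d) {α₀ cl : ℝ} (hα₀ : 0 < α₀) (hcl : 0 < cl) :
    ∃ c : ℝ, 0 < c ∧ ∀ α : ℝ, α₀ ≤ α → α < 2 → ∀ k : 𝔼 → 𝔼 → ℝ, EnergyLowerBound k α cl →
      ∀ v : 𝔼 → ℝ, Measurable v → MemLp v 2 volume →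
      ∀ (x₀ : 𝔼) (r : ℝ), 0 < r → ∀ A ⊆ ball x₀ r, MeasurableSet A → (∀ x ∉ A, v x = 0) →
      ∀ s : ℝ, 0 < s →
        volume A ≤ ENNReal.ofReal (s ^ d / 4) * volume (ball (0 : 𝔼) 1) →
        ENNReal.ofReal (c * s ^ (-α)) * ∫⁻ x, ENNReal.ofReal (v x ^ 2) ≤
          energy k Set.univ v := by
  obtain ⟨c₀, hc₀, hc⟩ := exists_fracConst_lower hd hα₀
  have : Nonempty (Fin d) := ⟨⟨0, hd⟩⟩
  have hω : 0 < (volume (ball (0 : 𝔼) 1)).toReal :=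
    ENNReal.toReal_pos (measure_ball_pos _ _ one_pos).ne' measure_ball_lt_top.ne
  refine ⟨cl * c₀ * (volume (ball (0 : 𝔼) 1)).toReal / 4, by positivity, ?_⟩
  intro α hα hα2 k hk v hv hv2 x₀ r hr A hAr hA hvA s hs hvol
  have hα' := hα₀.trans_le hα
  calc _ = ENNReal.ofReal (cl * c₀) * (ENNReal.ofReal (s ^ (-α) / 4) *
        volume (ball (0 : 𝔼) 1) * ∫⁻ x, ENNReal.ofReal (v x ^ 2)) := by
        rw [← ENNReal.ofReal_toReal (a := volume (ball (0 : 𝔼) 1)) measure_ball_lt_top.ne,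
          ← mul_assoc, ← ENNReal.ofReal_mul (by positivity), ← ENNReal.ofReal_mul (by positivity),
          ENNReal.toReal_ofReal hω.le]
        ring_nf
    _ ≤ ENNReal.ofReal (cl * c₀) * (ENNReal.ofReal (2 - α) * ∫⁻ x, ∫⁻ y in ball x s,
        ENNReal.ofReal ((v y - v x) ^ 2 * ‖y - x‖ ^ (-(d : ℝ) - α))) := by
        exact mul_le_mul' le_rfl (faberKrahn hd hv hα' hα2 hs hA hvA hvol)
    _ = ENNReal.ofReal cl * ∫⁻ x, ∫⁻ y in ball x s, ENNReal.ofReal (c₀ * (2 - α)) *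
        ENNReal.ofReal ((v y - v x) ^ 2 * ‖y - x‖ ^ (-(d : ℝ) - α)) := by
        simp_rw [lintegral_const_mul' _ _ ENNReal.ofReal_ne_top]
        rw [← mul_assoc, ← mul_assoc, ← ENNReal.ofReal_mul (by positivity),
          ← ENNReal.ofReal_mul hcl.le]
        ring_nf
    _ ≤ ENNReal.ofReal cl * ∫⁻ x, ∫⁻ y in ball x s,
        ENNReal.ofReal ((v y - v x) ^ 2 * fracKernel α x y) := by
        gcongr with x y
        rw [← ENNReal.ofReal_mul (mul_nonneg hc₀.le (by linarith))]
        apply ENNReal.ofReal_le_ofReal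
        unfold fracKernel
        have := mul_le_mul_of_nonneg_right (hc α hα hα2)
          (by positivity : 0 ≤ (v y - v x) ^ 2 * ‖y - x‖ ^ (-(d : ℝ) - α))
        linarith
    _ ≤ ENNReal.ofReal cl * energy (fracKernel α) (ball x₀ (r + s)) v := by
        -- Nothing ties `s` to `r`; enlarging the ball by `s` catches every contributing pair, and
        -- `(𝓔_≥)` is available on all balls.
        gcongr
        exact lintegral_near_le_energy fun x hx => hvA x fun h => hx (hAr h)
    _ ≤ energy k (ball x₀ (r + s)) v := hk x₀ (r + s) (by positivity) v (hv2.restrict _)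
    _ ≤ _ := energy_mono (Set.subset_univ _) v

/-! ### Energies on the product space, cutoffs and truncations -/

theorem IsKernel.sq_mul_nonneg {k : 𝔼 → 𝔼 → ℝ} (hk : IsKernel k) (v : 𝔼 → ℝ) (x y : 𝔼) :
    0 ≤ (v y - v x) ^ 2 * k x y := by
  by_cases h : x = y
  · simp [h]
  · exact mul_nonneg (sq_nonneg _) (hk.nonneg x y h)

theorem IsKernel.energy_univ {k : 𝔼 → 𝔼 → ℝ} (hk : IsKernel k) {v : 𝔼 → ℝ}
    (hv : Measurable v) :
    energy k Set.univ v =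
      ∫⁻ p : 𝔼 × 𝔼, ENNReal.ofReal ((v p.2 - v p.1) ^ 2 * k p.1 p.2) := by
  rw [Measure.volume_eq_prod, lintegral_prod]
  · simp [energy]
  · exact (AEMeasurable.mul (by fun_prop) hk.aemeasurable).ennreal_ofReal

theorem IsKernel.integrable_sq {k : 𝔼 → 𝔼 → ℝ} (hk : IsKernel k) {v : 𝔼 → ℝ}
    (hv : Measurable v) (hE : energy k Set.univ v < ∞) :
    Integrable fun p : 𝔼 × 𝔼 => (v p.2 - v p.1) ^ 2 * k p.1 p.2 := by
  refine ⟨(AEMeasurable.mul (by fun_prop) hk.aemeasurable).aestronglyMeasurable, ?_⟩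
  have h0 : 0 ≤ᵐ[volume] fun p : 𝔼 × 𝔼 => (v p.2 - v p.1) ^ 2 * k p.1 p.2 :=
    Filter.Eventually.of_forall fun p => hk.sq_mul_nonneg v p.1 p.2
  rw [hasFiniteIntegral_iff_ofReal h0, ← hk.energy_univ hv]
  exact hE

theorem IsKernel.integrable_mul {k : 𝔼 → 𝔼 → ℝ} (hk : IsKernel k) {u v : 𝔼 → ℝ}
    (hu : Measurable u) (hv : Measurable v) (hEu : energy k Set.univ u < ∞)
    (hEv : energy k Set.univ v < ∞) :
    Integrable fun p : 𝔼 × 𝔼 => (u p.2 - u p.1) * (v p.2 - v p.1) * k p.1 p.2 := by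
  refine ((hk.integrable_sq hu hEu).add (hk.integrable_sq hv hEv)).mono'
    (AEMeasurable.mul (by fun_prop) hk.aemeasurable).aestronglyMeasurable
    (Filter.Eventually.of_forall fun p => ?_)
  by_cases h : p.1 = p.2
  · simp [h]
  · have h0 := hk.nonneg _ _ h
    rw [Real.norm_eq_abs, abs_mul, abs_of_nonneg h0, Pi.add_apply, ← add_mul]
    refine mul_le_mul_of_nonneg_right (abs_le.2 ⟨?_, ?_⟩) h0 <;>
    nlinarith [sq_nonneg ((u p.2 - u p.1) + (v p.2 - v p.1)),
      sq_nonneg ((u p.2 - u p.1) - (v p.2 - v p.1)), sq_nonneg (u p.2 - u p.1),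
      sq_nonneg (v p.2 - v p.1)]

theorem IsKernel.form_eq {k : 𝔼 → 𝔼 → ℝ} (hk : IsKernel k) {u v : 𝔼 → ℝ}
    (hu : Measurable u) (hv : Measurable v) (hEu : energy k Set.univ u < ∞)
    (hEv : energy k Set.univ v < ∞) :
    form k u v = ∫ p : 𝔼 × 𝔼, (u p.2 - u p.1) * (v p.2 - v p.1) * k p.1 p.2 :=
  (integral_prod _ (hk.integrable_mul hu hv hEu hEv)).symm

/-- Lipschitz cutoffs with values in `[0, 1]`. -/
structure IsCutoff (L : ℝ) (g : 𝔼 → ℝ) : Prop where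
  nonneg : ∀ x, 0 ≤ g x
  le_one : ∀ x, g x ≤ 1
  lipschitz : ∀ x y, |g y - g x| ≤ L * ‖y - x‖
  measurable : Measurable g

theorem IsCutoff.sq_le {L : ℝ} {g : 𝔼 → ℝ} (hg : IsCutoff L g) (x y : 𝔼) :
    (g y - g x) ^ 2 ≤ min 1 (L ^ 2 * ‖y - x‖ ^ 2) := by
  refine le_min ?_ ?_
  · have h1 := hg.nonneg x
    have h2 := hg.nonneg y
    have h3 := hg.le_one x
    have h4 := hg.le_one y
    nlinarith
  · rw [← mul_pow, ← sq_abs]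
    exact pow_le_pow_left₀ (abs_nonneg _) (hg.lipschitz x y) 2

/-- The Lévy condition controls the inner integral uniformly in `x`. Only finiteness is used, to
make test functions admissible; the quantitative bound comes from (U2). -/
theorem IsKernel.lintegral_cutoff_lt_top {k : 𝔼 → 𝔼 → ℝ} (hk : IsKernel k) {L : ℝ} {g w : 𝔼 → ℝ}
    (hg : IsCutoff L g) (hw : Measurable w) (hw2 : MemLp w 2 volume) :
    ∫⁻ x, ∫⁻ y, ENNReal.ofReal (w x ^ 2 * (g y - g x) ^ 2 * k x y) < ∞ := by
  set S := ⨆ x, ∫⁻ y, ENNReal.ofReal (min 1 (‖y - x‖ ^ 2) * k x y) with hS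
  have hw3 : ∫⁻ x, ENNReal.ofReal (w x ^ 2) < ∞ := by
    have := hw2.integrable_sq.2
    rwa [hasFiniteIntegral_iff_ofReal (Filter.Eventually.of_forall fun x => sq_nonneg _)] at this
  calc _ ≤ ∫⁻ x, (ENNReal.ofReal (w x ^ 2) * (ENNReal.ofReal (1 + L ^ 2) * S)) := by
        refine lintegral_mono fun x => ?_
        calc _ ≤ ∫⁻ y, ENNReal.ofReal (w x ^ 2) * (ENNReal.ofReal (1 + L ^ 2) *
              ENNReal.ofReal (min 1 (‖y - x‖ ^ 2) * k x y)) := by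
              refine lintegral_mono fun y => ?_
              rw [← ENNReal.ofReal_mul (by positivity), ← ENNReal.ofReal_mul (by positivity)]
              apply ENNReal.ofReal_le_ofReal
              by_cases h : x = y
              · simp [h]
              · rw [mul_assoc, ← mul_assoc (1 + L ^ 2)]
                refine mul_le_mul_of_nonneg_left ?_ (sq_nonneg _)
                refine mul_le_mul_of_nonneg_right ?_ (hk.nonneg x y h)
                refine (hg.sq_le x y).trans ?_
                have hL := sq_nonneg L
                have hy := sq_nonneg ‖y - x‖
                rcases le_total 1 (‖y - x‖ ^ 2) with h1 | h1
                · rw [min_eq_left h1]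
                  exact (min_le_left _ _).trans (by linarith)
                · rw [min_eq_right h1]
                  exact (min_le_right _ _).trans (by linarith)
          _ = ENNReal.ofReal (w x ^ 2) * (ENNReal.ofReal (1 + L ^ 2) *
              ∫⁻ y, ENNReal.ofReal (min 1 (‖y - x‖ ^ 2) * k x y)) := by
              rw [lintegral_const_mul' _ _ ENNReal.ofReal_ne_top,
                lintegral_const_mul' _ _ ENNReal.ofReal_ne_top]
          _ ≤ _ := by
              gcongr
              exact le_iSup (fun x => ∫⁻ y, ENNReal.ofReal (min 1 (‖y - x‖ ^ 2) * k x y)) x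
    _ = (∫⁻ x, ENNReal.ofReal (w x ^ 2)) * (ENNReal.ofReal (1 + L ^ 2) * S) :=
        lintegral_mul_const _ (by fun_prop)
    _ < ∞ := ENNReal.mul_lt_top hw3 (ENNReal.mul_lt_top ENNReal.ofReal_lt_top hk.levy)

/-- Discrete product rule: the increment of `g w` is `g(y)` times the increment of `w` plus `w(x)`
times the increment of `g`. -/
theorem MemH.cutoff_mul {k : 𝔼 → 𝔼 → ℝ} (hk : IsKernel k) {L : ℝ} {g w : 𝔼 → ℝ}
    (hg : IsCutoff L g) (hw : Measurable w) (hH : MemH k w) : MemH k fun x => g x * w x := by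
  have hgm := hg.measurable
  refine ⟨hH.1.mono (by fun_prop) (Filter.Eventually.of_forall fun x => ?_), ?_⟩
  · rw [norm_mul, Real.norm_eq_abs, abs_of_nonneg (hg.nonneg x)]
    exact mul_le_of_le_one_left (norm_nonneg _) (hg.le_one x)
  have hm : AEMeasurable (fun p : 𝔼 × 𝔼 =>
      ENNReal.ofReal (w p.1 ^ 2 * (g p.2 - g p.1) ^ 2 * k p.1 p.2)) volume :=
    (AEMeasurable.mul (by fun_prop) hk.aemeasurable).ennreal_ofReal
  have hm2 : AEMeasurable (fun p : 𝔼 × 𝔼 =>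
      ENNReal.ofReal ((w p.2 - w p.1) ^ 2 * k p.1 p.2)) volume :=
    (AEMeasurable.mul (by fun_prop) hk.aemeasurable).ennreal_ofReal
  rw [hk.energy_univ (by fun_prop)]
  calc _ ≤ ∫⁻ p : 𝔼 × 𝔼, (ENNReal.ofReal 2 * ENNReal.ofReal ((w p.2 - w p.1) ^ 2 * k p.1 p.2) +
        ENNReal.ofReal 2 * ENNReal.ofReal (w p.1 ^ 2 * (g p.2 - g p.1) ^ 2 * k p.1 p.2)) := by
        refine lintegral_mono fun p => ?_
        by_cases h : p.1 = p.2
        · simp [h]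
        have h0 := hk.nonneg _ _ h
        rw [← ENNReal.ofReal_mul (by norm_num), ← ENNReal.ofReal_mul (by norm_num),
          ← ENNReal.ofReal_add (by positivity) (by positivity)]
        apply ENNReal.ofReal_le_ofReal
        rw [show 2 * ((w p.2 - w p.1) ^ 2 * k p.1 p.2) +
          2 * (w p.1 ^ 2 * (g p.2 - g p.1) ^ 2 * k p.1 p.2) =
          (2 * (w p.2 - w p.1) ^ 2 + 2 * (w p.1 * (g p.2 - g p.1)) ^ 2) * k p.1 p.2 by ring]
        refine mul_le_mul_of_nonneg_right ?_ h0
        have h1 : (g p.2 * (w p.2 - w p.1)) ^ 2 ≤ (w p.2 - w p.1) ^ 2 := by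
          rw [mul_pow]
          refine mul_le_of_le_one_left (sq_nonneg _) ?_
          exact pow_le_one₀ (hg.nonneg _) (hg.le_one _)
        nlinarith [sq_nonneg (g p.2 * (w p.2 - w p.1) - w p.1 * (g p.2 - g p.1))]
    _ = ENNReal.ofReal 2 * energy k Set.univ w + ENNReal.ofReal 2 *
        ∫⁻ x, ∫⁻ y, ENNReal.ofReal (w x ^ 2 * (g y - g x) ^ 2 * k x y) := by
        rw [lintegral_add_left' (hm2.const_mul _), lintegral_const_mul'' _ hm2,
          lintegral_const_mul'' _ hm, hk.energy_univ hw, Measure.volume_eq_prod,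
          lintegral_prod _ hm]
    _ < ∞ := ENNReal.add_lt_top.2 ⟨ENNReal.mul_lt_top ENNReal.ofReal_lt_top hH.2,
        ENNReal.mul_lt_top ENNReal.ofReal_lt_top (hk.lintegral_cutoff_lt_top hg hw hH.1)⟩

theorem MemH.truncate {k : 𝔼 → 𝔼 → ℝ} (hk : IsKernel k) {u : 𝔼 → ℝ} (hu : Measurable u)
    (hH : MemH k u) {l : ℝ} (hl : 0 ≤ l) : MemH k fun x => max (u x - l) 0 := by
  refine ⟨hH.1.mono (by fun_prop) (Filter.Eventually.of_forall fun x => ?_), ?_⟩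
  · rw [Real.norm_eq_abs, abs_of_nonneg (le_max_right _ _), Real.norm_eq_abs]
    exact max_le ((by linarith : u x - l ≤ u x).trans (le_abs_self _)) (abs_nonneg _)
  · refine lt_of_le_of_lt ?_ hH.2
    unfold energy
    refine lintegral_mono fun x => lintegral_mono fun y => ENNReal.ofReal_le_ofReal ?_
    by_cases h : x = y
    · simp [h]
    refine mul_le_mul_of_nonneg_right ?_ (hk.nonneg x y h)
    rw [← sq_abs, ← sq_abs (u y - u x)]
    refine pow_le_pow_left₀ (abs_nonneg _) ?_ 2
    have := abs_max_sub_max_le_abs (u y - l) (u x - l) 0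
    rwa [sub_sub_sub_cancel_right] at this

/-! ### The Caccioppoli inequality -/

/-- Caccioppoli inequality for truncations of subsolutions. -/
theorem IsSubsolution.caccioppoli {k : 𝔼 → 𝔼 → ℝ} (hk : IsKernel k) {Ω : Set 𝔼}
    {u : 𝔼 → ℝ} (hu : Measurable u) (hH : MemH k u) (hsub : IsSubsolution k Ω u)
    {L : ℝ} {g : 𝔼 → ℝ} (hg : IsCutoff L g) (hgΩ : ∀ x ∉ Ω, g x = 0) {l : ℝ} (hl : 0 ≤ l) :
    energy k Set.univ (fun x => g x * max (u x - l) 0) ≤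
      ∫⁻ x, ∫⁻ y, ENNReal.ofReal
        (max (u x - l) 0 * max (u y - l) 0 * (g y - g x) ^ 2 * k x y) := by
  have hgm := hg.measurable
  set w : 𝔼 → ℝ := fun x => max (u x - l) 0 with hw
  have hwm : Measurable w := by fun_prop
  have hw0 : ∀ x, 0 ≤ w x := fun x => le_max_right _ _
  have hwH : MemH k w := hH.truncate hk hu hl
  have hgwH : MemH k fun x => g x * w x := hwH.cutoff_mul hk hg hwm
  have hφH : MemH k fun x => g x * (g x * w x) := hgwH.cutoff_mul hk hg (by fun_prop)
  set φ : 𝔼 → ℝ := fun x => g x * (g x * w x) with hφ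
  have hφm : Measurable φ := by fun_prop
  have hφ0 : ∀ x, 0 ≤ φ x := fun x =>
    mul_nonneg (hg.nonneg x) (mul_nonneg (hg.nonneg x) (hw0 x))
  have hform : form k u φ ≤ 0 := by
    refine hsub φ ⟨hφH, ?_⟩ (Filter.Eventually.of_forall hφ0)
    -- `Ω` is an arbitrary set. If it is not measurable, its complement is replaced by the larger
    -- measurable set where `φ` vanishes.
    by_cases hΩ : MeasurableSet Ω
    · exact (ae_restrict_iff' hΩ.compl).2 (Filter.Eventually.of_forall fun x hx => by
        simp [hφ, hgΩ x hx])
    · refine ae_restrict_of_ae_restrict_of_subset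
        (t := {x | φ x = 0}) (fun x hx => by simp [hφ, hgΩ x hx]) ?_
      exact (ae_restrict_iff' (hφm (measurableSet_singleton 0))).2
        (Filter.Eventually.of_forall fun x hx => hx)
  rw [hk.form_eq hu hφm hH.2 hφH.2] at hform
  have i1 := hk.integrable_sq (v := fun x => g x * w x) (by fun_prop) hgwH.2
  have i2 := hk.integrable_mul hwm hφm hwH.2 hφH.2
  have i3 := hk.integrable_mul hu hφm hH.2 hφH.2
  have h23 : ∫ p : 𝔼 × 𝔼, (w p.2 - w p.1) * (φ p.2 - φ p.1) * k p.1 p.2 ≤ 0 := by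
    refine (integral_mono i2 i3 fun p => ?_).trans hform
    by_cases h : p.1 = p.2
    · simp [h]
    refine mul_le_mul_of_nonneg_right ?_ (hk.nonneg _ _ h)
    -- Here `u - w = min(u, l)` attains its maximum `l` where `u ≥ l`, and `φ` vanishes where `u ≤
    -- l`, so the two increments never have opposite signs. Thus `u` may be replaced by `w` in the
    -- form.
    have hz : ∀ x y, 0 ≤ (u y - w y - (u x - w x)) * (φ y - φ x) := by
      intro x y
      have hx0 := hφ0 x
      have hy0 := hφ0 y
      rcases le_total (u x) l with hx | hx <;> rcases le_total (u y) l with hy | hy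
      · simp [hφ, hw, max_eq_right (sub_nonpos.2 hx), max_eq_right (sub_nonpos.2 hy)]
      · have e1 : w x = 0 := max_eq_right (sub_nonpos.2 hx)
        have e2 : w y = u y - l := max_eq_left (sub_nonneg.2 hy)
        have e3 : φ x = 0 := by simp [hφ, e1]
        rw [e1, e2, e3]
        exact mul_nonneg (by linarith) (by linarith)
      · have e1 : w y = 0 := max_eq_right (sub_nonpos.2 hy)
        have e2 : w x = u x - l := max_eq_left (sub_nonneg.2 hx)
        have e3 : φ y = 0 := by simp [hφ, e1]
        rw [e1, e2, e3]
        exact mul_nonneg_of_nonpos_of_nonpos (by linarith) (by linarith)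
      · have e1 : w y = u y - l := max_eq_left (sub_nonneg.2 hy)
        have e2 : w x = u x - l := max_eq_left (sub_nonneg.2 hx)
        rw [e1, e2]
        simp
    linarith [hz p.1 p.2]
  -- Algebraic identity behind the choice `φ = g² w`: after subtraction no increment of `w` remains.
  have hE2 : (fun p : 𝔼 × 𝔼 => w p.1 * w p.2 * (g p.2 - g p.1) ^ 2 * k p.1 p.2) =
      fun p => (g p.2 * w p.2 - g p.1 * w p.1) ^ 2 * k p.1 p.2 -
        (w p.2 - w p.1) * (φ p.2 - φ p.1) * k p.1 p.2 := by
    funext p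
    simp only [hφ]
    ring
  have i4 : Integrable (fun p : 𝔼 × 𝔼 => w p.1 * w p.2 * (g p.2 - g p.1) ^ 2 * k p.1 p.2) := by
    rw [hE2]; exact i1.sub i2
  have h4 : ∫ p : 𝔼 × 𝔼, (g p.2 * w p.2 - g p.1 * w p.1) ^ 2 * k p.1 p.2 ≤
      ∫ p : 𝔼 × 𝔼, w p.1 * w p.2 * (g p.2 - g p.1) ^ 2 * k p.1 p.2 := by
    rw [hE2, integral_sub i1 i2]
    linarith
  rw [hk.energy_univ (by fun_prop), ← ofReal_integral_eq_lintegral_ofReal i1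
    (Filter.Eventually.of_forall fun p => hk.sq_mul_nonneg (fun x => g x * w x) p.1 p.2)]
  refine (ENNReal.ofReal_le_ofReal h4).trans ?_
  rw [ofReal_integral_eq_lintegral_ofReal i4 (Filter.Eventually.of_forall fun p => ?_),
    Measure.volume_eq_prod, lintegral_prod _ i4.1.aemeasurable.ennreal_ofReal]
  by_cases h : p.1 = p.2
  · simp [h]
  · exact mul_nonneg (mul_nonneg (mul_nonneg (hw0 _) (hw0 _)) (sq_nonneg _)) (hk.nonneg _ _ h)

/-! ### Local and tail parts of the cutoff energy -/

/-- In polar coordinates, split at `|h| = 1/L`. The inner part gives `L^α`, its factor `1/(2 - α)`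
being cancelled by the prefactor, and the outer part gives `(2 - α)/α · L^α`; together `2/α · L^α`.
-/
theorem lintegral_min_mul_rpow_le (hd : 1 ≤ d) {α : ℝ} (hα : 0 < α) (hα2 : α < 2) {L : ℝ}
    (hL : 0 < L) :
    ∫⁻ h : 𝔼, ENNReal.ofReal ((2 - α) * (min 1 (L ^ 2 * ‖h‖ ^ 2) * ‖h‖ ^ (-(d : ℝ) - α))) ≤
      ENNReal.ofReal (d * (volume.real (ball (0 : 𝔼) 1)) * (2 / α) * L ^ α) := by
  have : Nonempty (Fin d) := ⟨⟨0, hd⟩⟩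
  set f : ℝ → ℝ := fun t => (2 - α) * (min 1 (L ^ 2 * t ^ 2) * t ^ (-(d : ℝ) - α)) with hf
  have hfn : ∀ h : 𝔼, 0 ≤ f ‖h‖ := fun h => by
    have : 0 ≤ 2 - α := by linarith
    simp only [hf]
    positivity
  have hpow : ∀ t : ℝ, 0 < t → t ^ (d - 1) * t ^ (-(d : ℝ) - α) = t ^ (-1 - α) := by
    intro t ht
    rw [← Real.rpow_natCast, ← Real.rpow_add ht, Nat.cast_sub hd]
    congr 1
    push_cast
    ring
  have e1 : Set.EqOn (fun t : ℝ => (2 - α) * L ^ 2 * t ^ (1 - α))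
      (fun t : ℝ => t ^ (d - 1) • f t) (Set.Ioc 0 L⁻¹) := by
    intro t ht
    have ht0 : 0 < t := ht.1
    have hLt : L * t ≤ 1 := by
      have := mul_le_mul_of_nonneg_left ht.2 hL.le
      rwa [mul_inv_cancel₀ hL.ne'] at this
    have : L ^ 2 * t ^ 2 ≤ 1 := by rw [← mul_pow]; exact pow_le_one₀ (by positivity) hLt
    simp only [hf, smul_eq_mul, min_eq_right this]
    have h2 : t ^ (1 - α) = t ^ 2 * t ^ (-1 - α) := by
      rw [← Real.rpow_natCast t 2, ← Real.rpow_add ht0]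
      congr 1
      push_cast
      ring
    rw [h2, ← hpow t ht0]
    ring
  have e2 : Set.EqOn (fun t : ℝ => (2 - α) * t ^ (-1 - α))
      (fun t : ℝ => t ^ (d - 1) • f t) (Set.Ioi L⁻¹) := by
    intro t ht
    have ht0 : 0 < t := (inv_pos.2 hL).trans ht
    have hLt : 1 ≤ L * t := by
      have := mul_le_mul_of_nonneg_left (le_of_lt ht) hL.le
      rwa [mul_inv_cancel₀ hL.ne'] at this
    have : 1 ≤ L ^ 2 * t ^ 2 := by rw [← mul_pow]; exact one_le_pow₀ hLt
    simp only [hf, smul_eq_mul, min_eq_left this]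
    rw [← hpow t ht0]
    ring
  have i1 : IntegrableOn (fun t : ℝ => (2 - α) * L ^ 2 * t ^ (1 - α)) (Set.Ioc 0 L⁻¹) := by
    have := (intervalIntegral.intervalIntegrable_rpow' (a := 0) (b := L⁻¹)
      (show -1 < 1 - α by linarith)).const_mul ((2 - α) * L ^ 2)
    rwa [intervalIntegrable_iff_integrableOn_Ioc_of_le (inv_pos.2 hL).le] at this
  have i2 : IntegrableOn (fun t : ℝ => (2 - α) * t ^ (-1 - α)) (Set.Ioi L⁻¹) :=
    (integrableOn_Ioi_rpow_of_lt (by linarith) (inv_pos.2 hL)).const_mul _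
  have j1 := i1.congr_fun e1 measurableSet_Ioc
  have j2 := i2.congr_fun e2 measurableSet_Ioi
  have hU : Set.Ioc 0 L⁻¹ ∪ Set.Ioi L⁻¹ = Set.Ioi 0 :=
    Set.Ioc_union_Ioi_eq_Ioi (inv_pos.2 hL).le
  have hI : IntegrableOn (fun t : ℝ => t ^ (d - 1) • f t) (Set.Ioi 0) := by
    rw [← hU]; exact j1.union j2
  have hval : ∫ t in Set.Ioi (0 : ℝ), t ^ (d - 1) • f t = 2 / α * L ^ α := by
    rw [← hU, setIntegral_union (by
        rw [Set.disjoint_left]; intro t ht ht'; exact absurd ht.2 (not_le.2 ht'))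
      measurableSet_Ioi j1 j2, ← setIntegral_congr_fun measurableSet_Ioc e1,
      ← setIntegral_congr_fun measurableSet_Ioi e2, integral_const_mul, integral_const_mul,
      ← intervalIntegral.integral_of_le (inv_pos.2 hL).le,
      integral_rpow (Or.inl (by linarith)),
      integral_Ioi_rpow_of_lt (by linarith) (inv_pos.2 hL)]
    have h1 : L⁻¹ ^ (1 - α + 1) = L ^ α / L ^ 2 := by
      rw [Real.inv_rpow hL.le, ← Real.rpow_neg hL.le, ← Real.rpow_natCast L 2,
        ← Real.rpow_sub hL]
      congr 1
      push_cast
      ring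
    have h2 : L⁻¹ ^ (-1 - α + 1) = L ^ α := by
      rw [Real.inv_rpow hL.le, ← Real.rpow_neg hL.le]
      congr 1
      ring
    rw [h1, h2, Real.zero_rpow (by linarith)]
    have h3 : 1 - α + 1 ≠ 0 := by linarith
    have h4 : -1 - α + 1 ≠ 0 := by linarith
    field_simp
    ring
  have hint : Integrable fun h : 𝔼 => f ‖h‖ := by
    rw [integrable_fun_norm_addHaar (volume : Measure 𝔼)]
    simpa using hI
  change ∫⁻ h : 𝔼, ENNReal.ofReal (f ‖h‖) ≤ _
  rw [← ofReal_integral_eq_lintegral_ofReal hint (Filter.Eventually.of_forall hfn),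
    integral_fun_norm_addHaar (volume : Measure 𝔼), finrank_euclideanSpace_fin, hval]
  apply ENNReal.ofReal_le_ofReal
  rw [nsmul_eq_mul, smul_eq_mul]
  apply le_of_eq
  ring

/-- The right-hand side of the Caccioppoli inequality is controlled by a local term and a tail
term. -/
theorem lintegral_cutoff_le (hd : 1 ≤ d) {α cK K : ℝ} (hα : 0 < α) (hα2 : α < 2) (hcK : 0 < cK)
    (hK₁ : cK * (d * (volume.real (ball (0 : 𝔼) 1)) * (2 / α)) ≤ K) (hK₂ : 2 * cK ≤ K)
    {k : 𝔼 → 𝔼 → ℝ} (hk : IsKernel k) (hU : KernelUpperBound k α cK) {x₀ : 𝔼} {r ρ R : ℝ}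
    (hr : 0 < r) (hρ : r / 2 ≤ ρ) (hρR : ρ < R) (hR : R ≤ r) {g : 𝔼 → ℝ}
    (hg : IsCutoff (2 / (R - ρ)) g) (hg0 : ∀ x ∉ ball x₀ ((ρ + R) / 2), g x = 0)
    {u w : 𝔼 → ℝ} (hw : Measurable w) (hw0 : ∀ x, 0 ≤ w x) (hwu : ∀ x, w x ≤ max (u x) 0) :
    ∫⁻ x, ∫⁻ y, ENNReal.ofReal (w x * w y * (g y - g x) ^ 2 * k x y) ≤
      ENNReal.ofReal (2 * K * (2 / ((R - ρ) / r)) ^ (d + 2) * r ^ (-α)) *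
        ((∫⁻ x in ball x₀ R, ENNReal.ofReal (w x ^ 2)) +
          ENNReal.ofReal (r ^ α) * tail α x₀ (r / 2) u *
            ∫⁻ x in ball x₀ R, ENNReal.ofReal (w x)) := by
  have hgm := hg.measurable
  set L := 2 / (R - ρ) with hL
  have hRρ : 0 < R - ρ := sub_pos.2 hρR
  have hL0 : 0 < L := by positivity
  set θ := (R - ρ) / r with hθ
  have hθ0 : 0 < θ := by positivity
  have hθ1 : 1 ≤ 2 / θ := by
    rw [le_div_iff₀ hθ0, one_mul, hθ, div_le_iff₀ hr]; linarith
  set D := (2 / θ) ^ (d + 2) with hD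
  have hD0 : 0 < D := by positivity
  have hK0 : 0 < K := by linarith
  have h2α : 0 < 2 - α := by linarith
  set j : 𝔼 → 𝔼 → ℝ := fun x y => cK * (2 - α) * ‖y - x‖ ^ (-(d : ℝ) - α) with hj
  have hj0 : ∀ x y, 0 ≤ j x y := fun x y => by simp only [hj]; positivity
  have hjs : ∀ x y, j x y = j y x := fun x y => by simp only [hj]; rw [norm_sub_rev]
  have hjm : Measurable fun p : 𝔼 × 𝔼 => j p.1 p.2 := by simp only [hj]; fun_prop
  -- `G` is one half of a symmetric majorant: a local piece with `x` in `B_R`, and a tail piece with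
  -- `y` outside `B_R`. Symmetry of `j` lets `G p + G p.swap` cover all positions of the pair.
  set G : 𝔼 × 𝔼 → ℝ≥0∞ := fun p =>
    (ball x₀ R).indicator (fun x => ENNReal.ofReal (w x ^ 2 * (g p.2 - g x) ^ 2 * j x p.2)) p.1 +
    (ball x₀ R)ᶜ.indicator (fun y => ENNReal.ofReal (g p.1 * w p.1 * w y * j p.1 y)) p.2 with hG
  have hGm : Measurable G := by
    have m1 : Measurable ((Prod.fst ⁻¹' ball x₀ R).indicator (fun p : 𝔼 × 𝔼 =>
        ENNReal.ofReal (w p.1 ^ 2 * (g p.2 - g p.1) ^ 2 * j p.1 p.2))) :=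
      Measurable.indicator (by fun_prop) (measurable_fst measurableSet_ball)
    have m2 : Measurable ((Prod.snd ⁻¹' (ball x₀ R)ᶜ).indicator (fun p : 𝔼 × 𝔼 =>
        ENNReal.ofReal (g p.1 * w p.1 * w p.2 * j p.1 p.2))) :=
      Measurable.indicator (by fun_prop) (measurable_snd measurableSet_ball.compl)
    exact m1.add m2
  have hgR : ∀ x ∉ ball x₀ R, g x = 0 := fun x hx =>
    hg0 x fun h => hx (ball_subset_ball (by linarith) h)
  have hgsq : ∀ x, g x ^ 2 ≤ g x := fun x => by
    have := hg.nonneg x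
    have := hg.le_one x
    nlinarith
  have hpt : ∀ p : 𝔼 × 𝔼,
      ENNReal.ofReal (w p.1 * w p.2 * (g p.2 - g p.1) ^ 2 * j p.1 p.2) ≤ G p + G p.swap := by
    rintro ⟨x, y⟩
    have hxy := mul_nonneg (hw0 x) (hw0 y)
    simp only [hG, Prod.fst_swap, Prod.snd_swap]
    by_cases hx : x ∈ ball x₀ R <;> by_cases hy : y ∈ ball x₀ R
    · simp only [Set.indicator_of_mem hx, Set.indicator_of_mem hy,
        Set.indicator_of_notMem (Set.notMem_compl_iff.2 hx),
        Set.indicator_of_notMem (Set.notMem_compl_iff.2 hy), add_zero]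
      rw [← ENNReal.ofReal_add (mul_nonneg (by positivity) (hj0 _ _))
        (mul_nonneg (by positivity) (hj0 _ _)), hjs y x]
      apply ENNReal.ofReal_le_ofReal
      have h1 : w x * w y ≤ w x ^ 2 + w y ^ 2 := by nlinarith [sq_nonneg (w x - w y)]
      have h2 := mul_le_mul_of_nonneg_right h1 (mul_nonneg (sq_nonneg (g y - g x)) (hj0 x y))
      nlinarith [h2]
    · simp only [Set.indicator_of_mem hx, Set.indicator_of_notMem hy,
        Set.indicator_of_notMem (Set.notMem_compl_iff.2 hx),
        Set.indicator_of_mem (Set.mem_compl hy), add_zero]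
      refine le_trans (ENNReal.ofReal_le_ofReal ?_) le_add_self
      rw [hgR y hy]
      have h2 := mul_le_mul_of_nonneg_right (hgsq x) (mul_nonneg hxy (hj0 x y))
      nlinarith [h2]
    · simp only [Set.indicator_of_notMem hx, Set.indicator_of_mem hy,
        Set.indicator_of_notMem (Set.notMem_compl_iff.2 hy),
        Set.indicator_of_mem (Set.mem_compl hx), add_zero, zero_add]
      refine le_trans (ENNReal.ofReal_le_ofReal ?_) le_add_self
      rw [hgR x hx, hjs y x]
      have h2 := mul_le_mul_of_nonneg_right (hgsq y) (mul_nonneg hxy (hj0 x y))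
      nlinarith [h2]
    · rw [hgR x hx, hgR y hy]
      simp
  have hin : ∀ x, ∫⁻ y, G (x, y) ≤ (ball x₀ R).indicator (fun x =>
      ENNReal.ofReal (K * D * r ^ (-α)) * (ENNReal.ofReal (w x ^ 2) +
        ENNReal.ofReal (r ^ α) * tail α x₀ (r / 2) u * ENNReal.ofReal (w x))) x := by
    intro x
    by_cases hx : x ∈ ball x₀ R
    swap
    · rw [Set.indicator_of_notMem hx]
      refine le_of_eq (lintegral_eq_zero_of_ae_eq_zero (Filter.Eventually.of_forall fun y => ?_))
      simp only [hG, Set.indicator_of_notMem hx, hgR x hx]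
      simp
    rw [Set.indicator_of_mem hx]
    simp only [hG, Set.indicator_of_mem hx]
    rw [lintegral_add_left (by fun_prop), mul_add]
    refine add_le_add ?_ ?_
    · calc _ ≤ ∫⁻ y, ENNReal.ofReal (w x ^ 2 * cK) * ENNReal.ofReal ((2 - α) *
            (min 1 (L ^ 2 * ‖y - x‖ ^ 2) * ‖y - x‖ ^ (-(d : ℝ) - α))) := by
            refine lintegral_mono fun y => ?_
            rw [← ENNReal.ofReal_mul (by positivity)]
            apply ENNReal.ofReal_le_ofReal
            have := mul_le_mul_of_nonneg_right (hg.sq_le x y)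
              (mul_nonneg (sq_nonneg (w x)) (hj0 x y))
            simp only [hj] at this ⊢
            nlinarith [this]
        _ = ENNReal.ofReal (w x ^ 2 * cK) * ∫⁻ h : 𝔼, ENNReal.ofReal ((2 - α) *
            (min 1 (L ^ 2 * ‖h‖ ^ 2) * ‖h‖ ^ (-(d : ℝ) - α))) := by
            rw [lintegral_const_mul' _ _ ENNReal.ofReal_ne_top]
            congr 1
            exact lintegral_sub_right_eq_self (fun h : 𝔼 => ENNReal.ofReal ((2 - α) *
            (min 1 (L ^ 2 * ‖h‖ ^ 2) * ‖h‖ ^ (-(d : ℝ) - α)))) x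
        _ ≤ ENNReal.ofReal (w x ^ 2 * cK) *
            ENNReal.ofReal (d * (volume.real (ball (0 : 𝔼) 1)) * (2 / α) * L ^ α) :=
            mul_le_mul' le_rfl (lintegral_min_mul_rpow_le hd hα hα2 hL0)
        _ ≤ _ := by
            rw [← ENNReal.ofReal_mul (by positivity), ← ENNReal.ofReal_mul (by positivity)]
            apply ENNReal.ofReal_le_ofReal
            -- `L = (2/θ)/r` with `2/θ ≥ 1`, so the exponent `α` may be raised to `d + 2`, which
            -- removes the dependence on `α`.
            have hLα : L ^ α ≤ D * r ^ (-α) := by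
              have : L = 2 / θ * r⁻¹ := by rw [hL, hθ]; field_simp
              rw [this, Real.mul_rpow (by positivity) (by positivity), Real.inv_rpow hr.le,
                ← Real.rpow_neg hr.le, hD, ← Real.rpow_natCast]
              gcongr
              push_cast
              have : (0 : ℝ) ≤ d := by positivity
              linarith
            calc _ = w x ^ 2 * ((cK * (d * (volume.real (ball (0 : 𝔼) 1)) * (2 / α))) *
                  L ^ α) := by ring
              _ ≤ w x ^ 2 * (K * (D * r ^ (-α))) := by gcongr
              _ = _ := by ring
    · calc _ ≤ ∫⁻ y in (ball x₀ R)ᶜ, ENNReal.ofReal (K * D * w x) *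
            ENNReal.ofReal (max (u y) 0 * ‖y - x₀‖ ^ (-(d : ℝ) - α)) := by
            rw [lintegral_indicator measurableSet_ball.compl]
            refine setLIntegral_mono' measurableSet_ball.compl fun y hy => ?_
            rw [← ENNReal.ofReal_mul (mul_nonneg (by positivity) (hw0 x))]
            apply ENNReal.ofReal_le_ofReal
            by_cases hx' : x ∈ ball x₀ ((ρ + R) / 2)
            swap
            · rw [hg0 x hx']
              have := hw0 x
              have : 0 ≤ max (u y) 0 := le_max_right _ _
              simp only [zero_mul]
              positivity
            have hyR : R ≤ ‖y - x₀‖ := by simpa [dist_eq_norm] using hy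
            have hxm : ‖x - x₀‖ < (ρ + R) / 2 := by simpa [dist_eq_norm] using hx'
            have htri : ‖y - x₀‖ ≤ ‖y - x‖ + ‖x - x₀‖ := by
              simpa using norm_add_le (y - x) (x - x₀)
            have hθR : θ * R ≤ R - ρ := by
              rw [hθ, div_mul_eq_mul_div, div_le_iff₀ hr]; nlinarith
            have hR0 : 0 < R := by linarith
            have hθle : θ ≤ 1 := by rw [hθ, div_le_one hr]; linarith
            -- The cutoff lives inside the middle radius `(ρ + R)/2`, which keeps `x` away from `y ∉
            -- B_R` and makes `|y - x|` comparable to `|y - x₀|`.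
            have hlow : θ / 2 * ‖y - x₀‖ ≤ ‖y - x‖ := by nlinarith
            have hpos : 0 < θ / 2 * ‖y - x₀‖ := by
              have := hR0.trans_le hyR
              positivity
            have hd0 : (0 : ℝ) ≤ d := by positivity
            have hpw : ‖y - x‖ ^ (-(d : ℝ) - α) ≤ D * ‖y - x₀‖ ^ (-(d : ℝ) - α) := by
              refine (Real.rpow_le_rpow_of_nonpos hpos hlow (by linarith)).trans ?_
              rw [Real.mul_rpow (by positivity) (norm_nonneg _)]
              refine mul_le_mul_of_nonneg_right ?_ (by positivity)
              rw [hD, ← Real.rpow_natCast, ← inv_div, Real.inv_rpow (by positivity),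
                ← Real.rpow_neg (by positivity)]
              apply Real.rpow_le_rpow_of_exponent_le hθ1
              push_cast
              linarith
            have hgw : g x * w x ≤ w x := mul_le_of_le_one_left (hw0 x) (hg.le_one x)
            have hjle : j x y ≤ K * (D * ‖y - x₀‖ ^ (-(d : ℝ) - α)) := by
              simp only [hj]
              refine mul_le_mul (by nlinarith) hpw (by positivity) hK0.le
            calc g x * w x * w y * j x y ≤ w x * max (u y) 0 *
                  (K * (D * ‖y - x₀‖ ^ (-(d : ℝ) - α))) := by
                  have := hw0 x
                  refine mul_le_mul (mul_le_mul hgw (hwu y) (hw0 y) this) hjle (hj0 _ _) ?_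
                  exact mul_nonneg this (le_max_right _ _)
              _ = _ := by ring
        _ = ENNReal.ofReal (K * D * w x) * tail α x₀ R u := by
            rw [lintegral_const_mul' _ _ ENNReal.ofReal_ne_top]; rfl
        _ ≤ ENNReal.ofReal (K * D * w x) * tail α x₀ (r / 2) u := by
            refine mul_le_mul' le_rfl (lintegral_mono_set ?_)
            exact Set.compl_subset_compl.2 (ball_subset_ball (by linarith))
        _ = _ := by
            have : ENNReal.ofReal (K * D * w x) =
                ENNReal.ofReal (K * D * r ^ (-α)) * ENNReal.ofReal (r ^ α) *
                  ENNReal.ofReal (w x) := by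
              rw [← ENNReal.ofReal_mul (by positivity), ← ENNReal.ofReal_mul (by positivity)]
              congr 2
              rw [mul_assoc (K * D), ← Real.rpow_add hr]
              simp
            rw [this]
            ring
  calc _ = ∫⁻ p : 𝔼 × 𝔼, ENNReal.ofReal (w p.1 * w p.2 * (g p.2 - g p.1) ^ 2 * k p.1 p.2) := by
        rw [Measure.volume_eq_prod, lintegral_prod]
        exact (AEMeasurable.mul (by fun_prop) hk.aemeasurable).ennreal_ofReal
    _ ≤ ∫⁻ p : 𝔼 × 𝔼, (G p + G p.swap) := by
        refine lintegral_mono_ae ?_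
        filter_upwards [hU] with p hp
        refine le_trans (ENNReal.ofReal_le_ofReal ?_) (hpt p)
        exact mul_le_mul_of_nonneg_left hp
          (mul_nonneg (mul_nonneg (hw0 _) (hw0 _)) (sq_nonneg _))
    _ = 2 * ∫⁻ p : 𝔼 × 𝔼, G p := by
        rw [lintegral_add_left hGm, two_mul]
        congr 1
        rw [Measure.volume_eq_prod]
        exact lintegral_prod_swap _
    _ = 2 * ∫⁻ x, ∫⁻ y, G (x, y) := by
        rw [Measure.volume_eq_prod, lintegral_prod _ hGm.aemeasurable]
    _ ≤ 2 * ∫⁻ x in ball x₀ R, ENNReal.ofReal (K * D * r ^ (-α)) * (ENNReal.ofReal (w x ^ 2) +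
        ENNReal.ofReal (r ^ α) * tail α x₀ (r / 2) u * ENNReal.ofReal (w x)) := by
        rw [← lintegral_indicator measurableSet_ball]
        exact mul_le_mul' le_rfl (lintegral_mono hin)
    _ = _ := by
        rw [lintegral_const_mul' _ _ ENNReal.ofReal_ne_top, lintegral_add_left (by fun_prop),
          lintegral_const_mul _ (by fun_prop), ← mul_assoc]
        congr 1
        rw [show (2 : ℝ) * K * D * r ^ (-α) = 2 * (K * D * r ^ (-α)) by ring,
          ENNReal.ofReal_mul (by norm_num : (0 : ℝ) ≤ 2)]
        simp

theorem exists_cutoff (x₀ : 𝔼) {ρ R : ℝ} (h : ρ < R) :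
    ∃ g : 𝔼 → ℝ, IsCutoff (2 / (R - ρ)) g ∧ (∀ x ∉ ball x₀ ((ρ + R) / 2), g x = 0) ∧
      ∀ x ∈ ball x₀ ρ, g x = 1 := by
  have hR : 0 < R - ρ := sub_pos.2 h
  have hL : 0 < 2 / (R - ρ) := by positivity
  refine ⟨fun x => max 0 (min 1 (2 / (R - ρ) * ((ρ + R) / 2 - ‖x - x₀‖))),
    ⟨fun x => le_max_left _ _, fun x => max_le zero_le_one (min_le_left _ _), fun x y => ?_,
      by fun_prop⟩, fun x hx => ?_, fun x hx => ?_⟩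
  · have h1 : ∀ a b : ℝ, |max 0 (min 1 a) - max 0 (min 1 b)| ≤ |a - b| := by
      intro a b
      rw [max_comm 0 _, max_comm 0 _]
      refine (abs_max_sub_max_le_abs (min 1 a) (min 1 b) 0).trans ?_
      simpa using abs_min_sub_min_le_max 1 a 1 b
    refine (h1 _ _).trans ?_
    rw [← mul_sub, abs_mul, abs_of_pos hL]
    refine mul_le_mul_of_nonneg_left ?_ hL.le
    rw [sub_sub_sub_cancel_left, norm_sub_rev y x]
    simpa using abs_norm_sub_norm_le (x - x₀) (y - x₀)
  · have hx' : (ρ + R) / 2 ≤ ‖x - x₀‖ := by simpa [dist_eq_norm] using hx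
    refine max_eq_left ((min_le_right _ _).trans ?_)
    exact mul_nonpos_of_nonneg_of_nonpos hL.le (by linarith)
  · have hx' : ‖x - x₀‖ < ρ := by simpa [dist_eq_norm] using hx
    have h1 : 1 ≤ 2 / (R - ρ) * ((ρ + R) / 2 - ‖x - x₀‖) := by
      rw [div_mul_eq_mul_div, le_div_iff₀ hR]
      linarith
    simp only [min_eq_left h1]
    exact max_eq_right zero_le_one

/-! ### De Giorgi iteration -/

/-- The integral of `(u - l)₊²` over the ball of radius `ρ`. -/
noncomputable def truncMass (u : 𝔼 → ℝ) (x₀ : 𝔼) (ρ l : ℝ) : ℝ≥0∞ :=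
  ∫⁻ x in ball x₀ ρ, ENNReal.ofReal (max (u x - l) 0 ^ 2)

theorem truncMass_mono (u : 𝔼 → ℝ) (x₀ : 𝔼) {ρ R l l' : ℝ} (hρ : ρ ≤ R) (hl : l ≤ l') :
    truncMass u x₀ ρ l' ≤ truncMass u x₀ R l := by
  refine (lintegral_mono_set (ball_subset_ball hρ)).trans (lintegral_mono fun x => ?_)
  refine ENNReal.ofReal_le_ofReal (pow_le_pow_left₀ (le_max_right _ _) ?_ 2)
  exact max_le_max (by linarith) le_rfl

theorem truncMass_lt_top {u : 𝔼 → ℝ} (hu : MemLp u 2 volume) (x₀ : 𝔼) (ρ : ℝ) {l : ℝ}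
    (hl : 0 ≤ l) : truncMass u x₀ ρ l < ∞ := by
  have h1 : ∫⁻ x, ENNReal.ofReal (u x ^ 2) < ∞ := by
    have := hu.integrable_sq.2
    rwa [hasFiniteIntegral_iff_ofReal (Filter.Eventually.of_forall fun x => sq_nonneg _)] at this
  refine lt_of_le_of_lt ((setLIntegral_le_lintegral _ _).trans (lintegral_mono fun x => ?_)) h1
  refine ENNReal.ofReal_le_ofReal ?_
  rw [← sq_abs (u x)]
  refine pow_le_pow_left₀ (le_max_right _ _) (max_le ?_ (abs_nonneg _)) 2
  linarith [le_abs_self (u x)]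

/-- Chebyshev's inequality; it fixes the scale `s` in the Faber–Krahn inequality. -/
theorem volume_superlevel_le {u : 𝔼 → ℝ} (hu : Measurable u) (x₀ : 𝔼) {R l l' : ℝ} (hl : l < l') :
    ENNReal.ofReal ((l' - l) ^ 2) * volume (ball x₀ R ∩ {x | l' < u x}) ≤
      truncMass u x₀ R l := by
  have hA : MeasurableSet (ball x₀ R ∩ {x | l' < u x}) :=
    measurableSet_ball.inter (measurableSet_lt measurable_const hu)
  rw [← setLIntegral_const]
  refine le_trans ?_ (lintegral_mono_set
    (Set.inter_subset_left : ball x₀ R ∩ {x | l' < u x} ⊆ ball x₀ R))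
  refine setLIntegral_mono' hA fun x hx => ENNReal.ofReal_le_ofReal ?_
  have : l' < u x := hx.2
  exact pow_le_pow_left₀ (by linarith) (le_trans (by linarith) (le_max_left _ _)) 2

/-- Where `u > l'` one has `u - l ≥ l' - l`, so an `L¹` norm at the higher level is paid for by the
`L²` mass at the lower one. -/
theorem lintegral_truncate_le {u : 𝔼 → ℝ} (x₀ : 𝔼) {R l l' : ℝ} (hl : l < l') :
    ∫⁻ x in ball x₀ R, ENNReal.ofReal (max (u x - l') 0) ≤
      ENNReal.ofReal ((l' - l)⁻¹) * truncMass u x₀ R l := by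
  have hδ : 0 < l' - l := by linarith
  rw [truncMass, ← lintegral_const_mul' _ _ ENNReal.ofReal_ne_top]
  refine lintegral_mono fun x => ?_
  rw [← ENNReal.ofReal_mul (by positivity)]
  apply ENNReal.ofReal_le_ofReal
  rw [inv_mul_eq_div, le_div_iff₀ hδ]
  rcases le_total (u x) l' with h | h
  · rw [max_eq_right (by linarith : u x - l' ≤ 0), zero_mul]; positivity
  · rw [max_eq_left (by linarith : 0 ≤ u x - l'), max_eq_left (by linarith : 0 ≤ u x - l)]
    nlinarith

/-- This removes the variable exponent `β = α/d`: the prefactor is enlarged to be at least one and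
then bounded by its first power, while `y ≤ 1` allows `β` to drop to `β₀`. -/
theorem rpow_div_le {ω δ M y β β₀ : ℝ} (hω : 0 < ω) (hδ : 0 < δ) (hδM : δ ≤ M) (hy : 0 < y)
    (hy1 : y ≤ 1) (hβ₀ : β₀ ≤ β) (hβ : 0 ≤ β) (hβ1 : β ≤ 1) :
    (4 / ω * (M / δ) ^ 2 * y) ^ β ≤ 4 * (1 + 1 / ω) * (M / δ) ^ 2 * y ^ β₀ := by
  have h1 : 1 ≤ M / δ := by rwa [le_div_iff₀ hδ, one_mul]
  have hX : 1 ≤ 4 * (1 + 1 / ω) * (M / δ) ^ 2 := by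
    have h2 : 1 ≤ (M / δ) ^ 2 := one_le_pow₀ h1
    have h3 : 0 < 1 / ω := by positivity
    nlinarith
  have h4 : 4 / ω ≤ 4 * (1 + 1 / ω) := by
    rw [mul_add, mul_one_div]; linarith
  have hM : 0 < M := hδ.trans_le hδM
  calc _ ≤ (4 * (1 + 1 / ω) * (M / δ) ^ 2 * y) ^ β := by gcongr
    _ = (4 * (1 + 1 / ω) * (M / δ) ^ 2) ^ β * y ^ β := Real.mul_rpow (by positivity) hy.le
    _ ≤ (4 * (1 + 1 / ω) * (M / δ) ^ 2) ^ (1 : ℝ) * y ^ β₀ := by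
        refine mul_le_mul (Real.rpow_le_rpow_of_exponent_le hX hβ1)
          (Real.rpow_le_rpow_of_exponent_ge hy hy1 hβ₀) (by positivity) (by positivity)
    _ = _ := by rw [Real.rpow_one]

/-- One step of the De Giorgi iteration. -/
theorem exists_deGiorgi_step (hd : 2 ≤ d) {α₀ cl cK : ℝ} (hα₀ : 0 < α₀) (hcl : 0 < cl)
    (hcK : 0 < cK) :
    ∃ C : ℝ, 0 < C ∧ ∀ α : ℝ, α₀ ≤ α → α < 2 → ∀ k : 𝔼 → 𝔼 → ℝ, IsKernel k →
      EnergyLowerBound k α cl → KernelUpperBound k α cK →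
      ∀ (x₀ : 𝔼) (r : ℝ), 0 < r → ∀ u : 𝔼 → ℝ, Measurable u → MemH k u →
      IsSubsolution k (ball x₀ r) u →
      ∀ M : ℝ, ENNReal.ofReal (r ^ α) * tail α x₀ (r / 2) u ≤ ENNReal.ofReal M →
      ∀ ρ R l l' : ℝ, r / 2 ≤ ρ → ρ < R → R ≤ r → 0 ≤ l → l < l' → l' - l ≤ M →
        (truncMass u x₀ R l).toReal / (M ^ 2 * r ^ d) ≤ 1 →
        (truncMass u x₀ ρ l').toReal / (M ^ 2 * r ^ d) ≤
          C * (2 / ((R - ρ) / r)) ^ (d + 2) * (M / (l' - l)) ^ 3 *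
            ((truncMass u x₀ R l).toReal / (M ^ 2 * r ^ d)) ^ (1 + α₀ / d) := by
  have hd1 : 1 ≤ d := by omega
  have hdR : (2 : ℝ) ≤ d := by exact_mod_cast hd
  have : Nonempty (Fin d) := ⟨⟨0, hd1⟩⟩
  obtain ⟨c, hc, hlow⟩ := exists_energy_lower (d := d) hd1 hα₀ hcl
  set ω := volume.real (ball (0 : 𝔼) 1) with hω
  have hω0 : 0 < ω := ENNReal.toReal_pos (measure_ball_pos _ _ one_pos).ne' measure_ball_lt_top.ne
  set K := cK * (d * ω * (2 / α₀)) + 2 * cK with hK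
  have hK0 : 0 < K := by positivity
  refine ⟨16 * K * (1 + 1 / ω) / c, by positivity, ?_⟩
  intro α hα hα2 k hk hE hU x₀ r hr u hu hH hsub M hM ρ R l l' hρ hρR hR hl hll hδM hy1
  have hα' : 0 < α := hα₀.trans_le hα
  set δ := l' - l with hδ
  have hδ0 : 0 < δ := sub_pos.2 hll
  have hM0 : 0 < M := hδ0.trans_le hδM
  have hl' : 0 ≤ l' := by linarith
  have hYt : truncMass u x₀ R l ≠ ∞ := (truncMass_lt_top hH.1 x₀ R hl).ne
  have hYt' : truncMass u x₀ ρ l' ≠ ∞ := (truncMass_lt_top hH.1 x₀ ρ hl').ne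
  have hRρ : 0 < R - ρ := sub_pos.2 hρR
  have hYY : (truncMass u x₀ ρ l').toReal ≤ (truncMass u x₀ R l).toReal :=
    ENNReal.toReal_mono hYt (truncMass_mono u x₀ hρR.le hll.le)
  set Y := (truncMass u x₀ R l).toReal with hY
  set Y' := (truncMass u x₀ ρ l').toReal with hY'
  have hY0 : 0 ≤ Y := ENNReal.toReal_nonneg
  -- With `Y = 0` the scale `s` below would be zero.
  rcases hY0.eq_or_lt with h0 | hYpos
  · have : Y' = 0 := le_antisymm (hYY.trans h0.symm.le) ENNReal.toReal_nonneg
    rw [this, zero_div]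
    positivity
  have hYE : truncMass u x₀ R l = ENNReal.ofReal Y := (ENNReal.ofReal_toReal hYt).symm
  set y := Y / (M ^ 2 * r ^ d) with hy
  have hy0 : 0 < y := by positivity
  obtain ⟨g, hg, hg0, hg1⟩ := exists_cutoff x₀ hρR
  have hgm := hg.measurable
  set w : 𝔼 → ℝ := fun x => max (u x - l') 0 with hw
  have hwm : Measurable w := by fun_prop
  have hw0 : ∀ x, 0 ≤ w x := fun x => le_max_right _ _
  have hwu : ∀ x, w x ≤ max (u x) 0 := fun x => max_le_max (by linarith) le_rfl
  set D := (2 / ((R - ρ) / r)) ^ (d + 2) with hD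
  have hD0 : 0 < D := by positivity
  have hup : energy k Set.univ (fun x => g x * w x) ≤
      ENNReal.ofReal (4 * K * D * r ^ (-α) * (M / δ) * Y) := by
    refine (hsub.caccioppoli hk hu hH hg (fun x hx => hg0 x fun h => hx
      (ball_subset_ball (by linarith) h)) hl').trans ?_
    refine (lintegral_cutoff_le (K := K) hd1 hα' hα2 hcK ?_ ?_ hk hU hr hρ hρR hR hg hg0
      hwm hw0 hwu).trans ?_
    · have : cK * (d * ω * (2 / α)) ≤ cK * (d * ω * (2 / α₀)) := by gcongr
      linarith
    · have : 0 ≤ cK * (d * ω * (2 / α₀)) := by positivity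
      linarith
    have e1 : ∫⁻ x in ball x₀ R, ENNReal.ofReal (w x ^ 2) ≤ ENNReal.ofReal Y :=
      hYE ▸ truncMass_mono u x₀ le_rfl hll.le
    have e2 : ∫⁻ x in ball x₀ R, ENNReal.ofReal (w x) ≤ ENNReal.ofReal (δ⁻¹ * Y) := by
      refine (lintegral_truncate_le x₀ hll).trans ?_
      rw [hYE, ENNReal.ofReal_mul (by positivity)]
    calc _ ≤ ENNReal.ofReal (2 * K * D * r ^ (-α)) *
          (ENNReal.ofReal Y + ENNReal.ofReal M * ENNReal.ofReal (δ⁻¹ * Y)) := by gcongr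
      _ = ENNReal.ofReal (2 * K * D * r ^ (-α) * (Y + M * (δ⁻¹ * Y))) := by
          rw [← ENNReal.ofReal_mul hM0.le, ← ENNReal.ofReal_add hY0 (by positivity),
            ← ENNReal.ofReal_mul (by positivity)]
      _ ≤ _ := by
          apply ENNReal.ofReal_le_ofReal
          have h1 : 1 ≤ M / δ := by rwa [le_div_iff₀ hδ0, one_mul]
          calc _ = 2 * K * D * r ^ (-α) * Y * (1 + M / δ) := by ring
            _ ≤ 2 * K * D * r ^ (-α) * Y * (M / δ + M / δ) := by gcongr
            _ = _ := by ring
  set A : Set 𝔼 := ball x₀ R ∩ {x | l' < u x} with hA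
  have hAm : MeasurableSet A := measurableSet_ball.inter (measurableSet_lt measurable_const hu)
  -- This `s` turns the volume hypothesis of the Faber–Krahn inequality into exactly the Chebyshev
  -- bound `|A| ≤ Y/δ²`.
  set s : ℝ := (4 * Y / (ω * δ ^ 2)) ^ ((d : ℝ)⁻¹) with hs
  have hs0 : 0 < s := by positivity
  have hsd : s ^ d = 4 * Y / (ω * δ ^ 2) :=
    Real.rpow_inv_natCast_pow (by positivity) (by omega)
  have hvolA : volume A ≤ ENNReal.ofReal (s ^ d / 4) * volume (ball (0 : 𝔼) 1) := by
    have h1 := volume_superlevel_le hu x₀ (R := R) hll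
    rw [hYE] at h1
    have h2 : ENNReal.ofReal (s ^ d / 4) * volume (ball (0 : 𝔼) 1) =
        ENNReal.ofReal Y / ENNReal.ofReal (δ ^ 2) := by
      rw [← ENNReal.ofReal_toReal (a := volume (ball (0 : 𝔼) 1)) measure_ball_lt_top.ne,
        ← ENNReal.ofReal_mul (by positivity), ← ENNReal.ofReal_div_of_pos (by positivity)]
      congr 1
      change s ^ d / 4 * ω = _
      rw [hsd]
      field_simp
    rw [h2, ENNReal.le_div_iff_mul_le (Or.inl (by simpa using hδ0.ne'))
      (Or.inl ENNReal.ofReal_ne_top), mul_comm]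
    exact h1
  have hvA : ∀ x ∉ A, g x * w x = 0 := by
    intro x hx
    by_cases h1 : x ∈ ball x₀ R
    · have h2 : u x ≤ l' := not_lt.1 fun h => hx ⟨h1, h⟩
      simp [hw, h2]
    · rw [hg0 x fun h => h1 (ball_subset_ball (by linarith) h), zero_mul]
  have hwH : MemH k w := hH.truncate hk hu hl'
  have hlo := hlow α hα hα2 k hE (fun x => g x * w x) (by fun_prop)
    (hwH.cutoff_mul hk hg hwm).1 x₀ R (by linarith) A Set.inter_subset_left hAm hvA s hs0 hvolA
  have hY'le : ENNReal.ofReal Y' ≤ ∫⁻ x, ENNReal.ofReal ((g x * w x) ^ 2) := by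
    rw [hY', ENNReal.ofReal_toReal hYt']
    refine le_trans (setLIntegral_mono' measurableSet_ball fun x hx => ?_)
      (setLIntegral_le_lintegral (ball x₀ ρ) _)
    rw [hg1 x hx, one_mul]
  have hmain : c * s ^ (-α) * Y' ≤ 4 * K * D * r ^ (-α) * (M / δ) * Y := by
    rw [← ENNReal.ofReal_le_ofReal_iff (by positivity), ENNReal.ofReal_mul (by positivity)]
    exact (mul_le_mul' le_rfl hY'le).trans (hlo.trans hup)
  have hsr : (s / r) ^ α = (4 / ω * (M / δ) ^ 2 * y) ^ (α / d) := by
    have h1 : 4 / ω * (M / δ) ^ 2 * y = (s / r) ^ d := by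
      rw [div_pow s r d, hsd, hy]
      field_simp
    rw [h1, ← Real.rpow_natCast, ← Real.rpow_mul (by positivity)]
    congr 1
    field_simp
  -- Here `d ≥ 2` gives `α/d ≤ 1`. The two powers of `M/δ` join the one from the tail term to make
  -- the cube in the conclusion.
  have hbd : (s / r) ^ α ≤ 4 * (1 + 1 / ω) * (M / δ) ^ 2 * y ^ (α₀ / d) := by
    rw [hsr]
    refine rpow_div_le hω0 hδ0 hδM hy0 hy1 (by gcongr) (by positivity) ?_
    rw [div_le_one (by linarith)]
    linarith
  have hfin : Y' ≤ 4 * K * D / c * (M / δ) * (s / r) ^ α * Y := by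
    rw [Real.div_rpow hs0.le hr.le]
    rw [Real.rpow_neg hs0.le, Real.rpow_neg hr.le] at hmain
    have h1 : 0 < s ^ α := by positivity
    have h2 : 0 < r ^ α := by positivity
    have h3 := mul_le_mul_of_nonneg_left hmain (by positivity : 0 ≤ s ^ α / c)
    calc Y' = s ^ α / c * (c * (s ^ α)⁻¹ * Y') := by field_simp
      _ ≤ _ := h3
      _ = _ := by field_simp
  calc Y' / (M ^ 2 * r ^ d)
      ≤ 4 * K * D / c * (M / δ) * (4 * (1 + 1 / ω) * (M / δ) ^ 2 * y ^ (α₀ / d)) * Y /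
          (M ^ 2 * r ^ d) := by
        gcongr
        exact hfin.trans (by gcongr)
    _ = 16 * K * (1 + 1 / ω) / c * D * (M / δ) ^ 3 * (y ^ (1 : ℝ) * y ^ (α₀ / d)) := by
        rw [Real.rpow_one, hy]
        ring
    _ = _ := by rw [← Real.rpow_add hy0]

/-- The ratio `lam = Q^{-1/β}` satisfies `lam^β Q = 1`, so the decay of `y_j^β` offsets the growth
`Q^j`, and smallness of `y 0` supplies one more factor `lam` at each step. -/
theorem deGiorgi_sequence {y : ℕ → ℝ} {B Q β : ℝ} (hB : 0 < B) (hQ : 1 ≤ Q) (hβ : 0 < β)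
    (hy : ∀ j, 0 ≤ y j) (hy0 : y 0 ≤ 1) (h0 : B * Q ^ (1 / β) * y 0 ^ β ≤ 1)
    (hstep : ∀ j, y j ≤ 1 → y (j + 1) ≤ B * Q ^ j * y j ^ (1 + β)) (j : ℕ) :
    y j ≤ y 0 * (Q ^ (-(1 / β))) ^ j := by
  have hQ0 : 0 < Q := by linarith
  set lam := Q ^ (-(1 / β)) with hlam
  have hl0 : 0 < lam := by positivity
  have hl1 : lam ≤ 1 := Real.rpow_le_one_of_one_le_of_nonpos hQ (by simp [hβ.le])
  have hlβ : lam ^ β * Q = 1 := by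
    rw [hlam, ← Real.rpow_mul hQ0.le, show -(1 / β) * β = -1 by field_simp, Real.rpow_neg_one,
      inv_mul_cancel₀ hQ0.ne']
  have h0' : B * y 0 ^ β ≤ lam := by
    rw [hlam, Real.rpow_neg hQ0.le, ← one_div, le_div_iff₀ (by positivity)]
    linarith
  induction j with
  | zero => simp
  | succ j ih =>
    have h1 : y 0 * lam ^ j ≤ 1 := mul_le_one₀ hy0 (by positivity) (pow_le_one₀ hl0.le hl1)
    have hz := hy 0
    have hsum : ∀ t : ℝ, 0 ≤ t → t ^ (1 + β) = t * t ^ β := fun t ht => by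
      rw [Real.rpow_add_of_nonneg ht zero_le_one hβ.le, Real.rpow_one]
    calc y (j + 1) ≤ B * Q ^ j * y j ^ (1 + β) := hstep j (ih.trans h1)
      _ ≤ B * Q ^ j * (y 0 * lam ^ j) ^ (1 + β) := by
          have := hy j
          gcongr
      _ = (B * y 0 ^ β) * (y 0 * lam ^ j) * (lam ^ β * Q) ^ j := by
          rw [hsum _ (by positivity), Real.mul_rpow hz (by positivity), mul_pow,
            ← Real.rpow_natCast lam j, ← Real.rpow_natCast (lam ^ β) j,
            ← Real.rpow_mul hl0.le, ← Real.rpow_mul hl0.le, mul_comm (j : ℝ) β]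
          ring
      _ = (B * y 0 ^ β) * (y 0 * lam ^ j) := by rw [hlβ, one_pow, mul_one]
      _ ≤ lam * (y 0 * lam ^ j) := by gcongr
      _ = _ := by ring

/-- De Giorgi's local boundedness lemma between two concentric balls. -/
theorem exists_deGiorgi_bound (hd : 2 ≤ d) {α₀ cl cK : ℝ} (hα₀ : 0 < α₀) (hcl : 0 < cl)
    (hcK : 0 < cK) :
    ∃ C : ℝ, 0 < C ∧ ∀ α : ℝ, α₀ ≤ α → α < 2 → ∀ k : 𝔼 → 𝔼 → ℝ, IsKernel k →
      EnergyLowerBound k α cl → KernelUpperBound k α cK →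
      ∀ (x₀ : 𝔼) (r : ℝ), 0 < r → ∀ u : 𝔼 → ℝ, Measurable u → MemH k u →
      IsSubsolution k (ball x₀ r) u →
      ∀ M : ℝ, 0 < M → ENNReal.ofReal (r ^ α) * tail α x₀ (r / 2) u ≤ ENNReal.ofReal M →
      ∀ ρ R : ℝ, r / 2 ≤ ρ → ρ < R → R ≤ r →
        C * (2 / ((R - ρ) / r)) ^ (d + 2) *
          ((truncMass u x₀ R 0).toReal / (M ^ 2 * r ^ d)) ^ (α₀ / d) ≤ 1 →
        ∀ᵐ x ∂volume.restrict (ball x₀ ρ), u x ≤ M := by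
  obtain ⟨C, hC, hstep⟩ := exists_deGiorgi_step (d := d) hd hα₀ hcl hcK
  have hd0 : (0 : ℝ) < d := by positivity
  set β := α₀ / d with hβ
  have hβ0 : 0 < β := by positivity
  -- Halving the radius gap costs `2^{d+2}` per step, and halving the level gap costs `2³`.
  set Q : ℝ := 2 ^ (d + 5) with hQ
  have hQ1 : 1 < Q := one_lt_pow₀ (by norm_num) (by omega)
  -- The extra `Q` comes from the gaps having index `j + 1`; the summand `1` forces `y 0 ≤ 1`.
  refine ⟨C * Q * Q ^ (1 / β) + 1, by positivity, ?_⟩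
  intro α hα hα2 k hk hE hU x₀ r hr u hu hH hsub M hM hT ρ R hρ hρR hR hsmall
  have hRρ : 0 < R - ρ := sub_pos.2 hρR
  set D := (2 / ((R - ρ) / r)) ^ (d + 2) with hD
  have hD1 : 1 ≤ D := by
    refine one_le_pow₀ ?_
    rw [le_div_iff₀ (by positivity), one_mul, div_le_iff₀ hr]
    linarith
  set N := M ^ 2 * r ^ d with hN
  have hN0 : 0 < N := by positivity
  set y : ℕ → ℝ := fun j =>
    (truncMass u x₀ (ρ + (R - ρ) / 2 ^ j) (M - M / 2 ^ j)).toReal / N with hy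
  have hynn : ∀ j, 0 ≤ y j := fun j => by positivity
  have hy00 : y 0 = (truncMass u x₀ R 0).toReal / N := by simp [hy]
  rw [← hy00] at hsmall
  have hP : 0 ≤ C * Q * Q ^ (1 / β) := by positivity
  have hyb : 0 ≤ y 0 ^ β := Real.rpow_nonneg (hynn 0) _
  have hy0 : y 0 ≤ 1 := by
    by_contra h
    have h1 : 1 < y 0 ^ β := Real.one_lt_rpow (not_le.1 h) hβ0
    have : 1 ≤ (C * Q * Q ^ (1 / β) + 1) * D := by nlinarith
    nlinarith
  have hseq := deGiorgi_sequence (y := y) (B := C * Q * D) (Q := Q) (β := β) (by positivity)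
    hQ1.le hβ0 hynn hy0 (by nlinarith [mul_nonneg (zero_le_one.trans hD1) hyb]) (fun j hj => by
      have h2j : (0 : ℝ) < 2 ^ j := by positivity
      have h2j1 : (1 : ℝ) ≤ 2 ^ j := one_le_pow₀ (by norm_num)
      have := hstep α hα hα2 k hk hE hU x₀ r hr u hu hH hsub M hT
        (ρ + (R - ρ) / 2 ^ (j + 1)) (ρ + (R - ρ) / 2 ^ j) (M - M / 2 ^ j) (M - M / 2 ^ (j + 1))
        (hρ.trans (by linarith [div_pos hRρ (by positivity : (0 : ℝ) < 2 ^ (j + 1))]))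
        (by gcongr
            · norm_num
            · omega)
        (by have : (R - ρ) / 2 ^ j ≤ R - ρ := div_le_self hRρ.le h2j1
            linarith)
        (by have : M / 2 ^ j ≤ M := div_le_self hM.le h2j1
            linarith)
        (by gcongr
            · norm_num
            · omega)
        (by have : M / 2 ^ j ≤ M := div_le_self hM.le h2j1
            have : 0 < M / 2 ^ (j + 1) := by positivity
            linarith) hj
      refine this.trans (le_of_eq ?_)
      have e1 : M - M / 2 ^ (j + 1) - (M - M / 2 ^ j) = M / 2 ^ (j + 1) := by
        field_simp
        ring
      have e2 : ρ + (R - ρ) / 2 ^ j - (ρ + (R - ρ) / 2 ^ (j + 1)) = (R - ρ) / 2 ^ (j + 1) := by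
        field_simp
        ring
      have e3 : 2 / ((R - ρ) / 2 ^ (j + 1) / r) = 2 ^ (j + 1) * (2 / ((R - ρ) / r)) := by
        field_simp
      have e4 : M / (M / 2 ^ (j + 1)) = 2 ^ (j + 1) := by field_simp
      have e5 : ((2 : ℝ) ^ (j + 1)) ^ (d + 2) * (2 ^ (j + 1)) ^ 3 = Q * Q ^ j := by
        rw [hQ, ← pow_add, ← pow_mul, ← pow_succ', ← pow_mul]
        congr 1
        ring
      rw [e1, e2, e3, e4, mul_pow]
      change C * (((2 : ℝ) ^ (j + 1)) ^ (d + 2) * D) * (2 ^ (j + 1)) ^ 3 * y j ^ (1 + β) = _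
      generalize ((2 : ℝ) ^ (j + 1)) = a at e5 ⊢
      generalize y j ^ (1 + β) = z
      linear_combination C * D * z * e5)
  have hzero : truncMass u x₀ ρ M = 0 := by
    have hle : ∀ j, (truncMass u x₀ ρ M).toReal / N ≤ y 0 * (Q ^ (-(1 / β))) ^ j := by
      intro j
      refine le_trans ?_ (hseq j)
      have h2j1 : (1 : ℝ) ≤ 2 ^ j := one_le_pow₀ (by norm_num)
      have h1 : M / 2 ^ j ≤ M := div_le_self hM.le h2j1
      refine div_le_div_of_nonneg_right (ENNReal.toReal_mono
        (truncMass_lt_top hH.1 x₀ _ (by linarith)).ne (truncMass_mono u x₀ ?_ ?_)) hN0.le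
      · have : 0 < (R - ρ) / 2 ^ j := by positivity
        linarith
      · have : 0 < M / 2 ^ j := by positivity
        linarith
    have hlim : Filter.Tendsto (fun j : ℕ => y 0 * (Q ^ (-(1 / β))) ^ j) Filter.atTop
        (nhds (y 0 * 0)) :=
      (tendsto_pow_atTop_nhds_zero_of_lt_one (by positivity)
        (Real.rpow_lt_one_of_one_lt_of_neg hQ1 (by simp [hβ0]))).const_mul _
    have h1 := ge_of_tendsto' hlim hle
    rw [mul_zero] at h1
    have h2 : (truncMass u x₀ ρ M).toReal = 0 := by
      refine le_antisymm ?_ ENNReal.toReal_nonneg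
      by_contra h
      exact absurd h1 (not_le.2 (div_pos (not_le.1 h) hN0))
    exact ((ENNReal.toReal_eq_zero_iff _).1 h2).resolve_right
      (truncMass_lt_top hH.1 x₀ ρ hM.le).ne
  rw [truncMass, lintegral_eq_zero_iff (by fun_prop)] at hzero
  filter_upwards [hzero] with x hx
  have h1 : max (u x - M) 0 ^ 2 ≤ 0 := ENNReal.ofReal_eq_zero.1 hx
  have h2 : max (u x - M) 0 = 0 := by
    have := le_antisymm h1 (sq_nonneg _)
    exact pow_eq_zero_iff (two_ne_zero) |>.1 this
  have := le_max_left (u x - M) 0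
  linarith

/-! ### From `L²` to `L^q` with `q ≤ 2` -/

/-- Interpolation with the supremum, pointwise: `t² ≤ N^{2-q} t^q` for `0 ≤ t ≤ N`. -/
theorem truncMass_zero_le {u : 𝔼 → ℝ} (x₀ : 𝔼) {ρ r q N : ℝ} (hρ : ρ ≤ r) (hq : 0 < q)
    (hq2 : q ≤ 2) (hN : 0 ≤ N) (h : ∀ᵐ x ∂volume.restrict (ball x₀ ρ), u x ≤ N) :
    truncMass u x₀ ρ 0 ≤
      ENNReal.ofReal (N ^ (2 - q)) * ∫⁻ x in ball x₀ r, ENNReal.ofReal (max (u x) 0 ^ q) := by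
  refine le_trans ?_ (mul_le_mul' le_rfl (lintegral_mono_set (ball_subset_ball hρ)))
  rw [← lintegral_const_mul' _ _ ENNReal.ofReal_ne_top]
  refine lintegral_mono_ae ?_
  filter_upwards [h] with x hx
  rw [← ENNReal.ofReal_mul (by positivity), sub_zero]
  apply ENNReal.ofReal_le_ofReal
  have h0 : 0 ≤ max (u x) 0 := le_max_right _ _
  have h1 : max (u x) 0 ^ 2 = max (u x) 0 ^ (2 - q) * max (u x) 0 ^ q := by
    rw [← Real.rpow_add_of_nonneg h0 (by linarith) hq.le, ← Real.rpow_natCast]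
    norm_num
  rw [h1]
  refine mul_le_mul_of_nonneg_right ?_ (by positivity)
  exact Real.rpow_le_rpow h0 (max_le hx hN) (by linarith)

/-- Local boundedness of subsolutions in terms of the `L^q` norm of the positive part, `q ≤ 2`. -/
theorem exists_local_bound (hd : 2 ≤ d) {q α₀ cl cK : ℝ} (hq : 0 < q) (hq2 : q ≤ 2)
    (hα₀ : 0 < α₀) (hcl : 0 < cl) (hcK : 0 < cK) :
    ∃ C : ℝ, 0 < C ∧ ∀ α : ℝ, α₀ ≤ α → α < 2 → ∀ k : 𝔼 → 𝔼 → ℝ, IsKernel k →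
      EnergyLowerBound k α cl → KernelUpperBound k α cK →
      ∀ (x₀ : 𝔼) (r : ℝ), 0 < r → ∀ u : 𝔼 → ℝ, Measurable u → MemH k u →
      IsSubsolution k (ball x₀ r) u →
      ∀ M : ℝ, 0 < M → ENNReal.ofReal (r ^ α) * tail α x₀ (r / 2) u ≤ ENNReal.ofReal M →
        ENNReal.ofReal (C / r ^ d) * ∫⁻ x in ball x₀ r, ENNReal.ofReal (max (u x) 0 ^ q) ≤
          ENNReal.ofReal (M ^ q) →
        ∀ᵐ x ∂volume.restrict (ball x₀ (r / 2)), u x ≤ M := by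
  obtain ⟨C, hC, hDG⟩ := exists_deGiorgi_bound (d := d) hd hα₀ hcl hcK
  have hd0 : (0 : ℝ) < d := by positivity
  set β := α₀ / d with hβ
  have hβ0 : 0 < β := by positivity
  -- `b` is chosen so that the gain `b^{-qβ}` per level cancels the loss `2^{d+2}` per halving of
  -- the radius gap. The `16` in `C'` comes from `2/θ = 16 · 2ⁿ` for the radii below.
  set b : ℝ := 2 ^ (((d + 2 : ℕ) : ℝ) / (q * β)) with hb
  have hb1 : 1 < b := Real.one_lt_rpow (by norm_num) (by positivity)
  have hb0 : 0 < b := by linarith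
  have hbq : (b ^ q) ^ β = 2 ^ (d + 2) := by
    rw [← Real.rpow_mul hb0.le, hb, ← Real.rpow_mul (by norm_num),
      div_mul_cancel₀ _ (by positivity), Real.rpow_natCast]
  set C' := b ^ (2 - q) * (C * 16 ^ (d + 2)) ^ (1 / β) with hC'
  have hC'0 : 0 < C' := by positivity
  refine ⟨C', hC'0, ?_⟩
  intro α hα hα2 k hk hE hU x₀ r hr u hu hH hsub M hM hT hJ
  have hrd : 0 < r ^ d := by positivity
  have hJ' : ∫⁻ x in ball x₀ r, ENNReal.ofReal (max (u x) 0 ^ q) ≤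
      ENNReal.ofReal (M ^ q * r ^ d / C') := by
    calc _ = ENNReal.ofReal (r ^ d / C') * (ENNReal.ofReal (C' / r ^ d) *
          ∫⁻ x in ball x₀ r, ENNReal.ofReal (max (u x) 0 ^ q)) := by
          rw [← mul_assoc, ← ENNReal.ofReal_mul (by positivity)]
          have : r ^ d / C' * (C' / r ^ d) = 1 := by field_simp
          rw [this]
          simp
      _ ≤ ENNReal.ofReal (r ^ d / C') * ENNReal.ofReal (M ^ q) := by gcongr
      _ = _ := by
          rw [← ENNReal.ofReal_mul (by positivity)]
          congr 1
          ring
  have hMb : ∀ n : ℕ, M ≤ M * b ^ n := fun n =>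
    le_mul_of_one_le_right hM.le (one_le_pow₀ hb1.le)
  have hTb : ∀ n : ℕ, ENNReal.ofReal (r ^ α) * tail α x₀ (r / 2) u ≤
      ENNReal.ofReal (M * b ^ n) := fun n => hT.trans (ENNReal.ofReal_le_ofReal (hMb n))
  set ρ : ℕ → ℝ := fun j => r * (3 / 4 - 1 / 4 / 2 ^ j) with hρ
  -- Downward induction: the cruder bound `M b^{n+1}` on the larger ball turns the `L^q` hypothesis
  -- into `L²` smallness at level `M bⁿ`, and the De Giorgi bound then applies on the smaller ball.
  have hdesc : ∀ n : ℕ, (∀ᵐ x ∂volume.restrict (ball x₀ (ρ n)), u x ≤ M * b ^ n) →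
      ∀ᵐ x ∂volume.restrict (ball x₀ (ρ 0)), u x ≤ M := by
    intro n
    induction n with
    | zero => intro h; simpa using h
    | succ n ih =>
      intro h
      refine ih ?_
      have h2n : (1 : ℝ) ≤ 2 ^ n := one_le_pow₀ (by norm_num)
      have h2n0 : (0 : ℝ) < 2 ^ n := by positivity
      have hρr : ρ (n + 1) ≤ r := by
        have : 0 < 1 / 4 / (2 : ℝ) ^ (n + 1) := by positivity
        simp only [hρ]
        nlinarith
      have hdiff : ρ (n + 1) - ρ n = r / (8 * 2 ^ n) := by
        simp only [hρ]
        field_simp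
        ring
      refine hDG α hα hα2 k hk hE hU x₀ r hr u hu hH hsub (M * b ^ n) (by positivity)
        (hTb n) (ρ n) (ρ (n + 1)) ?_ ?_ hρr ?_
      · have : 1 / 4 / (2 : ℝ) ^ n ≤ 1 / 4 := div_le_self (by norm_num) h2n
        simp only [hρ]
        nlinarith
      · have : 0 < ρ (n + 1) - ρ n := by rw [hdiff]; positivity
        linarith
      · have hY : truncMass u x₀ (ρ (n + 1)) 0 ≤ ENNReal.ofReal
            ((M * b ^ (n + 1)) ^ (2 - q) * (M ^ q * r ^ d / C')) := by
          refine (truncMass_zero_le x₀ hρr hq hq2 (by positivity) h).trans ?_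
          rw [ENNReal.ofReal_mul (by positivity)]
          exact mul_le_mul' le_rfl hJ'
        have hY2 := ENNReal.toReal_mono ENNReal.ofReal_ne_top hY
        rw [ENNReal.toReal_ofReal (by positivity)] at hY2
        have hy : (truncMass u x₀ (ρ (n + 1)) 0).toReal / ((M * b ^ n) ^ 2 * r ^ d) ≤
            b ^ (2 - q) / C' * ((b ^ q) ^ n)⁻¹ := by
          rw [div_le_iff₀ (by positivity)]
          refine hY2.trans (le_of_eq ?_)
          have e1 : (M * b ^ (n + 1)) ^ (2 - q) =
              M ^ 2 / M ^ q * (b ^ (2 - q) * ((b ^ n) ^ 2 / (b ^ q) ^ n)) := by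
            rw [pow_succ, Real.mul_rpow hM.le (by positivity),
              Real.mul_rpow (by positivity) hb0.le, Real.rpow_sub hM,
              Real.rpow_sub (by positivity : 0 < b ^ n)]
            have e2 : (b ^ n) ^ q = (b ^ q) ^ n := by
              rw [← Real.rpow_natCast, ← Real.rpow_natCast, ← Real.rpow_mul hb0.le,
                ← Real.rpow_mul hb0.le, mul_comm]
            rw [e2, Real.rpow_two, Real.rpow_two]
            ring
          rw [e1]
          field_simp
        have hCb : b ^ (2 - q) / C' = ((C * 16 ^ (d + 2)) ^ (1 / β))⁻¹ := by
          rw [hC']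
          field_simp
        calc _ ≤ C * (2 / ((ρ (n + 1) - ρ n) / r)) ^ (d + 2) *
              (b ^ (2 - q) / C' * ((b ^ q) ^ n)⁻¹) ^ β := by
              have : 0 < (ρ (n + 1) - ρ n) / r := by rw [hdiff]; positivity
              gcongr
          _ = 1 := by
              have e3 : 2 / ((ρ (n + 1) - ρ n) / r) = 16 * 2 ^ n := by
                rw [hdiff]
                field_simp
                norm_num
              have e4 : ((b ^ q) ^ n) ^ β = (2 ^ n) ^ (d + 2) := by
                rw [← Real.rpow_natCast (b ^ q), ← Real.rpow_mul (by positivity), mul_comm,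
                  Real.rpow_mul (by positivity), hbq, Real.rpow_natCast, ← pow_mul, ← pow_mul,
                  mul_comm]
              rw [e3, hCb, Real.mul_rpow (by positivity) (by positivity),
                Real.inv_rpow (by positivity), Real.inv_rpow (by positivity), e4,
                ← Real.rpow_mul (by positivity), one_div_mul_cancel hβ0.ne', Real.rpow_one,
                mul_pow]
              field_simp
  -- The descent starts because `u ∈ L²`: for large `n` the mass normalized by `(M bⁿ)²` is small.
  -- This `n` depends on `u`, but no constant depends on `n`.
  have hbase : ∃ n : ℕ, ∀ᵐ x ∂volume.restrict (ball x₀ (ρ n)), u x ≤ M * b ^ n := by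
    set Y := (truncMass u x₀ r 0).toReal
    have hlim : Filter.Tendsto (fun n : ℕ => C * (2 / ((r - 3 / 4 * r) / r)) ^ (d + 2) *
        (Y / ((M * b ^ n) ^ 2 * r ^ d)) ^ β) Filter.atTop (nhds
          (C * (2 / ((r - 3 / 4 * r) / r)) ^ (d + 2) * 0 ^ β)) := by
      refine Filter.Tendsto.const_mul _ (Filter.Tendsto.rpow_const ?_ (Or.inr hβ0.le))
      refine Filter.Tendsto.const_div_atTop ?_ Y
      refine Filter.Tendsto.atTop_mul_const hrd ?_
      refine (Filter.tendsto_pow_atTop two_ne_zero).comp ?_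
      exact (tendsto_pow_atTop_atTop_of_one_lt hb1).const_mul_atTop hM
    rw [Real.zero_rpow hβ0.ne', mul_zero] at hlim
    obtain ⟨n, hn⟩ := (hlim.eventually_le_const one_pos).exists
    refine ⟨n, ae_restrict_of_ae_restrict_of_subset (t := ball x₀ (3 / 4 * r))
      (ball_subset_ball ?_) ?_⟩
    · have : 0 < 1 / 4 / (2 : ℝ) ^ n := by positivity
      simp only [hρ]
      nlinarith
    · exact hDG α hα hα2 k hk hE hU x₀ r hr u hu hH hsub (M * b ^ n) (by positivity)
        (hTb n) (3 / 4 * r) r (by linarith) (by linarith) le_rfl hn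
  obtain ⟨n, hn⟩ := hbase
  have := hdesc n hn
  have h0 : ρ 0 = r / 2 := by simp only [hρ]; ring
  rwa [h0] at this

/-! ### Change of representative and monotonicity of averages -/

theorem energy_univ_congr {k : 𝔼 → 𝔼 → ℝ} {u v : 𝔼 → ℝ} (h : u =ᵐ[volume] v) :
    energy k Set.univ u = energy k Set.univ v := by
  unfold energy
  simp only [Measure.restrict_univ]
  refine lintegral_congr_ae ?_
  filter_upwards [h] with x hx
  refine lintegral_congr_ae ?_
  filter_upwards [h] with y hy
  rw [hx, hy]

theorem form_congr_left {k : 𝔼 → 𝔼 → ℝ} {u v φ : 𝔼 → ℝ} (h : u =ᵐ[volume] v) :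
    form k u φ = form k v φ := by
  refine integral_congr_ae ?_
  filter_upwards [h] with x hx
  refine integral_congr_ae ?_
  filter_upwards [h] with y hy
  rw [hx, hy]

theorem posAverage_congr {u v : 𝔼 → ℝ} (h : u =ᵐ[volume] v) (q : ℝ) (x₀ : 𝔼) (r : ℝ) :
    posAverage q x₀ r u = posAverage q x₀ r v := by
  unfold posAverage
  congr 1
  refine laverage_congr ?_
  filter_upwards [ae_restrict_of_ae h] with x hx
  rw [hx]

theorem tail_congr {u v : 𝔼 → ℝ} (h : u =ᵐ[volume] v) (α : ℝ) (x₀ : 𝔼) (ρ : ℝ) :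
    tail α x₀ ρ u = tail α x₀ ρ v := by
  refine lintegral_congr_ae ?_
  filter_upwards [ae_restrict_of_ae h] with x hx
  rw [hx]

/-- Jensen's inequality for the normalized measure on the ball. -/
theorem posAverage_mono {u : 𝔼 → ℝ} (hu : Measurable u) {p q : ℝ} (hp : 0 < p) (hpq : p ≤ q)
    (x₀ : 𝔼) {r : ℝ} (hr : 0 < r) : posAverage p x₀ r u ≤ posAverage q x₀ r u := by
  have hq : 0 < q := hp.trans_le hpq
  set μ : Measure 𝔼 :=
    ((volume.restrict (ball x₀ r)) Set.univ)⁻¹ • (volume.restrict (ball x₀ r)) with hμ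
  have hne : NeZero (volume.restrict (ball x₀ r)) := ⟨by
    rw [Ne, Measure.restrict_eq_zero]; exact (measure_ball_pos _ _ hr).ne'⟩
  have hfin : IsFiniteMeasure (volume.restrict (ball x₀ r)) :=
    ⟨by simpa using measure_ball_lt_top⟩
  have hprob : IsProbabilityMeasure μ := inferInstance
  have key : ∀ s : ℝ, 0 < s →
      posAverage s x₀ r u = eLpNorm' (fun x => max (u x) 0) s μ := by
    intro s hs
    rw [posAverage, laverage, eLpNorm']
    congr 1
    refine lintegral_congr fun x => ?_
    have h0 : 0 ≤ max (u x) 0 := le_max_right _ _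
    rw [Real.enorm_eq_ofReal h0, ENNReal.ofReal_rpow_of_nonneg h0 hs.le]
  rw [key p hp, key q hq]
  exact eLpNorm'_le_eLpNorm'_of_exponent_le hp hpq μ (by fun_prop)

end

end Nonlocal

/-! ### Conclusion -/

theorem mainTheorem6 (d : ℕ) (hd : 3 ≤ d) (q cl cK α₀ : ℝ) (hq : 1 < q) (hcl : 0 < cl)
    (hcK : 0 < cK) (hα₀ : 0 < α₀) :
    ∃ C : ℝ, 0 < C ∧
      ∀ α : ℝ, α₀ ≤ α → α < 2 →
      ∀ k : EuclideanSpace ℝ (Fin d) → EuclideanSpace ℝ (Fin d) → ℝ,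
        Nonlocal.IsKernel k → Nonlocal.EnergyLowerBound k α cl →
        Nonlocal.KernelUpperBound k α cK →
      ∀ (x₀ : EuclideanSpace ℝ (Fin d)) (r : ℝ), 0 < r →
      ∀ u : EuclideanSpace ℝ (Fin d) → ℝ,
        Nonlocal.MemH k u → Nonlocal.IsSubsolution k (ball x₀ r) u →
        essSup (fun x => (u x : EReal)) (volume.restrict (ball x₀ (r / 2))) ≤
          ((ENNReal.ofReal C * Nonlocal.posAverage q x₀ r u +
            ENNReal.ofReal (r ^ α) * Nonlocal.tail α x₀ (r / 2) u : ℝ≥0∞) : EReal) := by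
  have : Nonempty (Fin d) := ⟨⟨0, by omega⟩⟩
  set p := min q 2 with hp
  have hp0 : 0 < p := lt_min (by linarith) two_pos
  obtain ⟨C, hC, hbound⟩ := Nonlocal.exists_local_bound (d := d) (by omega) hp0
    (min_le_right q 2) hα₀ hcl hcK
  set ω := volume.real (ball (0 : EuclideanSpace ℝ (Fin d)) 1) with hω
  have hω0 : 0 < ω := ENNReal.toReal_pos (measure_ball_pos _ _ one_pos).ne' measure_ball_lt_top.ne
  have hvol : volume (ball (0 : EuclideanSpace ℝ (Fin d)) 1) = ENNReal.ofReal ω :=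
    (ENNReal.ofReal_toReal measure_ball_lt_top.ne).symm
  -- The factor `ω` converts `C r^{-d} ∫` into an average, since `|B_r| = ω r^d`.
  refine ⟨(C * ω) ^ (1 / p), by positivity, ?_⟩
  intro α hα hα2 k hk hE hU x₀ r hr u hH hsub
  set v := hH.1.1.mk u
  have huv : u =ᵐ[volume] v := hH.1.1.ae_eq_mk
  have hv : Measurable v := hH.1.1.stronglyMeasurable_mk.measurable
  have hHv : Nonlocal.MemH k v :=
    ⟨(memLp_congr_ae huv).1 hH.1, Nonlocal.energy_univ_congr (k := k) huv ▸ hH.2⟩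
  have hsubv : Nonlocal.IsSubsolution k (ball x₀ r) v := fun φ hφ hφ0 =>
    Nonlocal.form_congr_left (k := k) huv ▸ hsub φ hφ hφ0
  rw [Nonlocal.posAverage_congr huv, Nonlocal.tail_congr huv]
  set V := ENNReal.ofReal ((C * ω) ^ (1 / p)) * Nonlocal.posAverage q x₀ r v +
    ENNReal.ofReal (r ^ α) * Nonlocal.tail α x₀ (r / 2) v with hV
  by_cases hVt : V = ∞
  · rw [hVt]; exact le_top
  -- Both summands of `V` lie below `M`, giving separately the tail and the `L^p` hypotheses. The
  -- strict inequality keeps `M` positive when `V = 0`.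
  have hM : ∀ M : ℝ, V.toReal < M → ∀ᵐ x ∂volume.restrict (ball x₀ (r / 2)), v x ≤ M := by
    intro M hM
    have hM0 : 0 < M := ENNReal.toReal_nonneg.trans_lt hM
    have hVM : V ≤ ENNReal.ofReal M := by
      rw [← ENNReal.ofReal_toReal hVt]; exact ENNReal.ofReal_le_ofReal hM.le
    refine hbound α hα hα2 k hk hE hU x₀ r hr v hv hHv hsubv M hM0
      (le_add_self.trans hVM) ?_
    have h1 : ENNReal.ofReal ((C * ω) ^ (1 / p)) * Nonlocal.posAverage p x₀ r v ≤
        ENNReal.ofReal M :=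
      (mul_le_mul' le_rfl (Nonlocal.posAverage_mono hv hp0 (min_le_left q 2) x₀ hr)).trans
        (le_self_add.trans hVM)
    have h2 := ENNReal.rpow_le_rpow h1 hp0.le
    rw [ENNReal.ofReal_rpow_of_pos hM0, ENNReal.mul_rpow_of_nonneg _ _ hp0.le,
      ENNReal.ofReal_rpow_of_pos (by positivity), ← Real.rpow_mul (by positivity),
      one_div_mul_cancel hp0.ne', Real.rpow_one, Nonlocal.posAverage, ← ENNReal.rpow_mul,
      one_div_mul_cancel hp0.ne', ENNReal.rpow_one, setLAverage_eq,
      Measure.addHaar_ball _ _ hr.le, finrank_euclideanSpace_fin,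
      hvol, ← ENNReal.ofReal_mul (by positivity), div_eq_mul_inv,
      ← ENNReal.ofReal_inv_of_pos (mul_pos (by positivity) hω0), mul_comm (∫⁻ _ in _, _ ∂_),
      ← mul_assoc, ← ENNReal.ofReal_mul (by positivity)] at h2
    refine le_trans (le_of_eq ?_) h2
    congr 2
    field_simp
  have hfin : ∀ᵐ x ∂volume.restrict (ball x₀ (r / 2)), v x ≤ V.toReal := by
    have : ∀ᵐ x ∂volume.restrict (ball x₀ (r / 2)), ∀ n : ℕ,
        v x ≤ V.toReal + 1 / ((n : ℝ) + 1) :=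
      ae_all_iff.2 fun n => hM _ (lt_add_of_pos_right _ (by positivity))
    filter_upwards [this] with x hx
    refine le_of_forall_pos_le_add fun ε hε => ?_
    obtain ⟨n, hn⟩ := exists_nat_one_div_lt hε
    linarith [hx n]
  refine essSup_le_of_ae_le _ ?_
  filter_upwards [hfin, ae_restrict_of_ae huv] with x hx hxu
  rw [hxu, ← ENNReal.ofReal_toReal hVt, EReal.coe_ennreal_ofReal]
  exact EReal.coe_le_coe_iff.2 (hx.trans (le_max_left _ _))
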